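/- **Model.** Let $r>0$, $c_T>0$, $0<x^*<B$, $\lambda>0$, $\delta\ge 0$. Between losses the capital $X_t$ of a household solves $$\frac{dX_t}{dt}=r\,[X_t-x^*]^+ + c_T\,[B-X_t]^+ .$$ Losses occur at the jump times of a Poisson process of intensity $\lambda$; at the $i$-th loss the capital is multiplied by $Z_i\in[0,1]$, where the $Z_i$ are i.i.d. with distribution function $G_Z$ and independent of the Poisson process. Let $\omega\ge 0$ be a measurable (extreme poverty) rate function which is integrable on $[a,x^*)$ for every $a\in(0,x^*)$, and also on $[0,x^*)$ in case $\mathbb P(Z_i=0)>0$. The time of extreme poverty of a household with $X_0=x$ is the killing time with rate $\omega(X_t)\mathbf 1_{\{X_t<x^*\}}$, that is, $$\tau_x=\inf\Big\{t\ge 0:\int_0^t\omega(X_s)\mathbf 1_{\{X_s<x^*\}}\,ds\ge E\Big\}\in[0,\infty],$$ with $E$ a standard exponential random variable independent of the capital process. For a measurable penalty function $w\ge 0$ put $$m(x)=\mathbb E\Big[w\big(X_{\tau_x-},|X_{\tau_x}-x^*|\big)\,e^{-\delta\tau_x}\,\mathbf 1_{\{\tau_x<\infty\}}\Big]\in[0,\infty],\qquad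 X_0=x .$$ If $r\neq c_T$, put $x^{**}=\dfrac{c_TB-rx^*}{r-c_T}$. Let $$\mathcal A(v)=\int_{[0,x^*/v)}m(vz)\,dG_Z(z)+\int_{[x^*/v,\,B/v)}m(vz)\,dG_Z(z)+\int_{[B/v,\,1]}m(vz)\,dG_Z(z)\qquad(v\ge B),$$ $$\mathcal C(v)=\int_{[0,x^*/v)}m(vz)\,dG_Z(z)+\int_{[x^*/v,\,1]}m(vz)\,dG_Z(z)\qquad(x^*\le v<B),$$ where the law of $Z_i$ is written $dG_Z$. **Theorem.** The following identities hold in $[0,\infty]$ (all integrands are non-negative). 1. If $x\ge B$, then $$m(x)=\frac{\lambda}{r}(x-x^*)^{\frac{\lambda+\delta}{r}}\int_x^\infty\frac{\mathcal A(v)}{(v-x^*)^{\frac{\lambda+\delta}{r}+1}}\,dv .$$ 2. If $r\ne c_T$ and $x^*\le x<B$, then $$m(x)=\frac{\lambda}{r-c_T}\int_x^B\Big(\frac{x+x^{**}}{v+x^{**}}\Big)^{\frac{\lambda+\delta}{r-c_T}}\frac{\mathcal C(v)}{v+x^{**}}\,dv+\frac{\lambda}{r}(B-x^*)^{\frac{\lambda+\delta}{r}}\Big(\frac{x+x^{**}}{B+x^{**}}\Big)^{\frac{\lambda+\delta}{r-c_T}}\int_B^\infty\frac{\mathcal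 A(v)}{(v-x^*)^{\frac{\lambda+\delta}{r}+1}}\,dv .$$ 3. If $r\ne c_T$ and $0<x<x^*$, then $$\begin{aligned} m(x)=&-\frac1{c_T}\int_x^{x^*}\Big(\frac{v-B}{x-B}\Big)^{\frac{\lambda+\delta}{c_T}}\frac{1}{v-B}\,e^{\frac1{c_T}\int_x^{v}\frac{\omega(u)}{u-B}du}\,\omega(v)\,w(v,x^*-v)\,dv\\ &-\frac{\lambda}{c_T}\int_x^{x^*}\Big(\frac{v-B}{x-B}\Big)^{\frac{\lambda+\delta}{c_T}}\frac{1}{v-B}\,e^{\frac1{c_T}\int_x^{v}\frac{\omega(u)}{u-B}du}\int_{[0,1]}m(vz)\,dG_Z(z)\,dv\\ &+\frac{\lambda}{r-c_T}\Big(\frac{x^*-B}{x-B}\Big)^{\frac{\lambda+\delta}{c_T}}\int_{x^*}^{B}\Big(\frac{x^*+x^{**}}{v+x^{**}}\Big)^{\frac{\lambda+\delta}{r-c_T}}\frac{1}{v+x^{**}}\,e^{\frac1{c_T}\int_x^{x^*}\frac{\omega(u)}{u-B}du}\,\mathcal C(v)\,dv\\ &+\frac{\lambda}{r}\Big(\frac{x^*-B}{x-B}\Big)^{\frac{\lambda+\delta}{c_T}}\Big(\frac{x^*+x^{**}}{B+x^{**}}\Big)^{\frac{\lambda+\delta}{r-c_T}}(B-x^*)^{\frac{\lambda+\delta}{r}}\int_B^\infty\frac{1}{(v-x^*)^{\frac{\lambda+\delta}{r}+1}}\,e^{\frac1{c_T}\int_x^{x^*}\frac{\omega(u)}{u-B}du}\,\mathcal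 A(v)\,dv . \end{aligned}$$ -/

import Mathlib

open MeasureTheory ProbabilityTheory Set Filter Topology
open scoped ENNReal NNReal

/-- The deterministic part of the capital model: growth rate `r`, cash transfer rate `cT`,
critical capital `xStar` and capital barrier level `B`. -/
structure CapitalModel where
  r : ℝ
  cT : ℝ
  xStar : ℝ
  B : ℝ
  r_pos : 0 < r
  cT_pos : 0 < cT
  xStar_pos : 0 < xStar
  xStar_lt_B : xStar < B

namespace CapitalModel

/-- Growth rate of the capital at level `u` between two losses:
`dX/dt = r [X - x*]⁺ + c_T [B - X]⁺`. -/
noncomputable def drift (M : CapitalModel) (u : ℝ) : ℝ :=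
  M.r * max (u - M.xStar) 0 + M.cT * max (M.B - u) 0

/-- The constant `x** = (c_T B - r x*) / (r - c_T)`, meaningful when `r ≠ c_T`. -/
noncomputable def xStarStar (M : CapitalModel) : ℝ :=
  (M.cT * M.B - M.r * M.xStar) / (M.r - M.cT)

theorem hasDerivAt_glue {F f g : ℝ → ℝ} {a t : ℝ} (h : f a = g a)
    (hf : t ≤ a → HasDerivAt f (F (f t)) t) (hg : a ≤ t → HasDerivAt g (F (g t)) t) :
    HasDerivAt (fun s => if s ≤ a then f s else g s) (F (if t ≤ a then f t else g t)) t := by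
  rcases lt_trichotomy t a with hta | hta | hta
  · rw [if_pos hta.le]
    refine (hf hta.le).congr_of_eventuallyEq ?_
    filter_upwards [Iio_mem_nhds hta] with s hs
    exact if_pos (le_of_lt hs)
  · subst hta
    rw [if_pos le_rfl]
    rw [← hasDerivWithinAt_univ, ← Set.Iic_union_Ici (a := t)]
    refine HasDerivWithinAt.union ?_ ?_
    · refine (hf le_rfl).hasDerivWithinAt.congr (fun s hs => if_pos hs) (if_pos le_rfl)
    · rw [h]
      refine (hg le_rfl).hasDerivWithinAt.congr (fun s hs => ?_) (by simp [h])
      rcases (show t ≤ s from hs).eq_or_lt with rfl | h'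
      · simp [h]
      · exact if_neg (not_le.2 h')
  · rw [if_neg (not_le.2 hta)]
    refine (hg hta.le).congr_of_eventuallyEq ?_
    filter_upwards [Ioi_mem_nhds hta] with s hs
    exact if_neg (not_le.2 hs)

/-- The growth equation has a solution from every starting point (unique, since `drift` is
Lipschitz). -/
theorem exists_flow (M : CapitalModel) (x : ℝ) :
    ∃ φ : ℝ → ℝ, φ 0 = x ∧ IsIntegralCurve φ (fun _ => M.drift) := by
  obtain ⟨r, c, a, B, hr, hc, ha, haB⟩ := M
  set F : ℝ → ℝ := drift ⟨r, c, a, B, hr, hc, ha, haB⟩ with hF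
  have hFu : ∀ u, F u = r * max (u - a) 0 + c * max (B - u) 0 := fun u => rfl
  have hBa : 0 < B - a := by linarith
  -- the part of the curve between `a` and `B`
  obtain ⟨v, t₁, ht₁, hv0, hv1, hv⟩ : ∃ (v : ℝ → ℝ) (t₁ : ℝ), t₁ ≤ 0 ∧ v 0 = B ∧ v t₁ = a ∧
      ∀ t, HasDerivAt v (r * (B - a) * Real.exp ((r - c) * t)) t ∧
        r * (B - a) * Real.exp ((r - c) * t) = r * (v t - a) + c * (B - v t) := by
    by_cases hk : r - c = 0
    · refine ⟨fun t => B + r * (B - a) * t, -1 / r, ?_, by simp, ?_, fun t => ⟨?_, ?_⟩⟩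
      · exact div_nonpos_of_nonpos_of_nonneg (by norm_num) hr.le
      · field_simp; ring
      · have := ((hasDerivAt_id t).const_mul (r * (B - a))).const_add B
        simpa [hk] using this
      · have : c = r := by linarith
        subst this
        simp; ring
    · refine ⟨fun t => B + r * (B - a) * ((Real.exp ((r - c) * t) - 1) / (r - c)),
        Real.log (c / r) / (r - c), ?_, by simp, ?_, fun t => ⟨?_, ?_⟩⟩
      · rcases lt_or_gt_of_ne hk with h | h
        · refine div_nonpos_of_nonneg_of_nonpos (Real.log_nonneg ?_) h.le
          rw [one_le_div hr]; linarith
        · refine div_nonpos_of_nonpos_of_nonneg (Real.log_nonpos (by positivity) ?_) h.le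
          rw [div_le_one hr]; linarith
      · have : (r - c) * (Real.log (c / r) / (r - c)) = Real.log (c / r) := by field_simp
        simp only [this]
        rw [Real.exp_log (by positivity)]
        field_simp; ring
      · have h1 : HasDerivAt (fun t => Real.exp ((r - c) * t))
            (Real.exp ((r - c) * t) * (r - c)) t := by
          simpa using ((hasDerivAt_id t).const_mul (r - c)).exp
        have h2 := (((h1.sub_const 1).div_const (r - c)).const_mul (r * (B - a))).const_add B
        refine h2.congr_deriv ?_
        field_simp
      · field_simp; ring
  have hvmono : StrictMono v := by
    refine strictMono_of_deriv_pos fun t => ?_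
    rw [(hv t).1.deriv]; positivity
  let low : ℝ → ℝ := fun t => B - (B - a) * Real.exp (-c * (t - t₁))
  let up : ℝ → ℝ := fun t => a + (B - a) * Real.exp (r * t)
  have hlow : ∀ t, t ≤ t₁ → HasDerivAt low (F (low t)) t := by
    intro t ht
    have h1 : HasDerivAt (fun t => Real.exp (-c * (t - t₁)))
        (Real.exp (-c * (t - t₁)) * (-c)) t := by
      simpa using (((hasDerivAt_id t).sub_const t₁).const_mul (-c)).exp
    have h2 := (h1.const_mul (B - a)).const_sub B
    have h3 : 1 ≤ Real.exp (-c * (t - t₁)) := Real.one_le_exp (by nlinarith)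
    have h4 : low t ≤ a := by simp only [low]; nlinarith
    refine h2.congr_deriv ?_
    rw [hFu, max_eq_right (by linarith), max_eq_left (by linarith)]
    simp only [low]; ring
  have hup : ∀ t, 0 ≤ t → HasDerivAt up (F (up t)) t := by
    intro t ht
    have h1 : HasDerivAt (fun t => Real.exp (r * t)) (Real.exp (r * t) * r) t := by
      simpa using ((hasDerivAt_id t).const_mul r).exp
    have h2 := (h1.const_mul (B - a)).const_add a
    have h3 : 1 ≤ Real.exp (r * t) := Real.one_le_exp (by positivity)
    have h4 : B ≤ up t := by simp only [up]; nlinarith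
    refine h2.congr_deriv ?_
    rw [hFu, max_eq_left (by linarith), max_eq_right (by linarith)]
    simp only [up]; ring
  have hmid : ∀ t, t₁ ≤ t → t ≤ 0 → HasDerivAt v (F (v t)) t := by
    intro t h1 h2
    have h3 := hvmono.monotone h1
    have h4 := hvmono.monotone h2
    rw [hv1] at h3
    rw [hv0] at h4
    rw [hFu, max_eq_left (by linarith), max_eq_left (by linarith), ← (hv t).2]
    exact (hv t).1
  let q : ℝ → ℝ := fun t => if t ≤ t₁ then low t else v t
  have hq : ∀ t, t ≤ 0 → HasDerivAt q (F (q t)) t := fun t ht =>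
    hasDerivAt_glue (by simp [low, hv1]) (hlow t) (fun h => hmid t h ht)
  let γ : ℝ → ℝ := fun t => if t ≤ 0 then q t else up t
  have hq0 : q 0 = up 0 := by
    rcases ht₁.eq_or_lt with h | h
    · exfalso; rw [h, hv0] at hv1; linarith
    · simp [q, up, not_le.2 h, hv0]
  have hγ : ∀ t, HasDerivAt γ (F (γ t)) t := fun t => hasDerivAt_glue hq0 (hq t) (hup t)
  have hcont : Continuous γ := continuous_iff_continuousAt.2 fun t => (hγ t).continuousAt
  have htop : Tendsto γ atTop atTop := by
    have h1 : Tendsto up atTop atTop := by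
      refine tendsto_atTop_add_const_left _ _ (Tendsto.const_mul_atTop hBa ?_)
      exact Real.tendsto_exp_atTop.comp (tendsto_id.const_mul_atTop hr)
    refine h1.congr' ?_
    filter_upwards [eventually_gt_atTop 0] with t ht
    simp [γ, not_le.2 ht]
  have hbot : Tendsto γ atBot atBot := by
    have h0 : Tendsto (fun t : ℝ => -c * (t - t₁)) atBot atTop :=
      (tendsto_atBot_add_const_right atBot (-t₁) tendsto_id).const_mul_atBot_of_neg
        (by linarith : -c < 0)
    have h1 : Tendsto low atBot atBot := by
      have h2 := (Real.tendsto_exp_atTop.comp h0).const_mul_atTop hBa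
      have h3 := tendsto_atBot_add_const_left atBot B (tendsto_neg_atTop_atBot.comp h2)
      refine h3.congr fun t => ?_
      simp [low, sub_eq_add_neg]
    refine h1.congr' ?_
    filter_upwards [eventually_le_atBot t₁] with t ht
    simp [γ, q, ht, ht.trans ht₁]
  obtain ⟨s, hs⟩ := hcont.surjective htop hbot x
  exact ⟨fun t => γ (t + s), by simpa using hs, fun t => (hγ (t + s)).comp_add_const t s⟩

/-- `M.flow x t`: the capital at time `t` of a household with capital `x` at time `0` which suffers
no loss, i.e. the solution of the growth equation started in `x`. -/
noncomputable def flow (M : CapitalModel) (x : ℝ) : ℝ → ℝ :=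
  Classical.choose (M.exists_flow x)

theorem flow_spec (M : CapitalModel) (x : ℝ) :
    M.flow x 0 = x ∧ IsIntegralCurve (M.flow x) (fun _ => M.drift) :=
  Classical.choose_spec (M.exists_flow x)

/-- Time of the `n`-th loss when `T k` is the waiting time between the `k`-th and the `(k+1)`-st
loss; `lossTime T 0 = 0`. -/
noncomputable def lossTime (T : ℕ → ℝ) (n : ℕ) : ℝ := ∑ k ∈ Finset.range n, T k

/-- Number of losses up to and including time `t`. -/
noncomputable def lossCount (T : ℕ → ℝ) (t : ℝ) : ℕ := {n : ℕ | lossTime T (n + 1) ≤ t}.ncard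

/-- Capital at the time of the `n`-th loss, just after it: over the waiting time `T n` the capital
follows the growth equation, then it is multiplied by the remaining proportion `Z n`. -/
noncomputable def capitalAtLoss (M : CapitalModel) (T Z : ℕ → ℝ) (x : ℝ) : ℕ → ℝ
  | 0 => x
  | n + 1 => Z n * M.flow (M.capitalAtLoss T Z x n) (T n)

/-- The capital `X_t` at time `t ≥ 0`, given `X_0 = x`, the waiting times `T` between losses and the
remaining proportions `Z`. -/
noncomputable def capital (M : CapitalModel) (T Z : ℕ → ℝ) (x t : ℝ) : ℝ :=
  M.flow (M.capitalAtLoss T Z x (lossCount T t)) (t - lossTime T (lossCount T t))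

/-- The accumulated extreme poverty rate `∫₀ᵗ ω(X_s) 1_{X_s < x*} ds`. -/
noncomputable def hazard (M : CapitalModel) (rate : ℝ → ℝ≥0) (T Z : ℕ → ℝ) (x t : ℝ) : ℝ≥0∞ :=
  ∫⁻ s in Icc 0 t, if M.capital T Z x s < M.xStar then (rate (M.capital T Z x s) : ℝ≥0∞) else 0

/-- The time of extreme poverty `τ = inf {t ≥ 0 : ∫₀ᵗ ω(X_s) 1_{X_s < x*} ds ≥ e}`, possibly `∞`.
When `e` is a standard exponential variable independent of `X`, this is the random time which occurs
in `[s, s + ds)` with conditional probability `ω(X_s) ds` when `X_s < x*` (and `0` when `X_s ≥ x*`),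
given the capital process and `τ ≥ s`. -/
noncomputable def povertyTime (M : CapitalModel) (rate : ℝ → ℝ≥0) (T Z : ℕ → ℝ) (e x : ℝ) : ℝ≥0∞ :=
  ⨅ (t : ℝ≥0) (_ : ENNReal.ofReal e ≤ M.hazard rate T Z x t), (t : ℝ≥0∞)

/-- The discounted penalty `w(X_{τ-}, |X_τ - x*|) e^{-δτ} 1_{τ < ∞}` on one path. -/
noncomputable def discountedPenalty (M : CapitalModel) (rate : ℝ → ℝ≥0) (w : ℝ → ℝ → ℝ≥0) (δ : ℝ)
    (T Z : ℕ → ℝ) (e x : ℝ) : ℝ≥0∞ :=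
  let τ := M.povertyTime rate T Z e x
  if τ = ∞ then 0
  else (w (Function.leftLim (M.capital T Z x) τ.toReal)
      |M.capital T Z x τ.toReal - M.xStar| : ℝ≥0∞) * ENNReal.ofReal (Real.exp (-δ * τ.toReal))

/-- The expected discounted penalty `m_δ(x) = E[w(X_{τ-}, |X_τ - x*|) e^{-δτ} 1_{τ < ∞}]`,
an element of `[0, ∞]`, for a household with initial capital `x`. -/
noncomputable def expectedPenalty (M : CapitalModel) {Ω : Type*} [MeasurableSpace Ω] (P : Measure Ω)
    (T Z : ℕ → Ω → ℝ) (E : Ω → ℝ) (rate : ℝ → ℝ≥0) (w : ℝ → ℝ → ℝ≥0) (δ x : ℝ) : ℝ≥0∞ :=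
  ∫⁻ o, M.discountedPenalty rate w δ (fun n => T n o) (fun n => Z n o) (E o) x ∂P

end CapitalModel

/-- The randomness of the model: waiting times `T n` between losses which are exponential with
parameter `lam` (so that losses occur at the jump times of a Poisson process of intensity `lam`),
remaining proportions `Z n` with law `G`, and a standard exponential variable `E`, all
independent. -/
structure IsCapitalNoise {Ω : Type*} [MeasurableSpace Ω] (P : Measure Ω) (lam : ℝ) (G : Measure ℝ)
    (T Z : ℕ → Ω → ℝ) (E : Ω → ℝ) : Prop where
  law_T : ∀ n, HasLaw (T n) (expMeasure lam) P
  law_Z : ∀ n, HasLaw (Z n) G P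
  law_E : HasLaw E (expMeasure 1) P
  indep : iIndepFun (fun i : (ℕ ⊕ ℕ) ⊕ Unit => Sum.elim (Sum.elim T Z) (fun _ => E) i) P

/-! ### The deterministic flow, its time parametrisation and its accumulated hazard. -/

namespace CapitalModel

/-! The identities are one renewal equation, obtained by conditioning on the first loss and then
made explicit on the three regions where the drift is affine. Starting from `x > 0`, the household
follows the flow until either the accumulated hazard `H` reaches the exponential level `E` or the
first loss occurs. Poverty before the first loss contributes the integral of `exp (-(λ + δ) t - H t)
ω w` along the flow. A first loss at time `t` happens before poverty with density `λ exp (-λ t - H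
t)`, and the process then restarts from `z` times the current capital, contributing the mean of `m`
over `z`.

The restart is legitimate because waiting times and proportions are i.i.d. and because `E`, given `E
> H t`, leaves a remainder `E - H t` that is again standard exponential. The pathwise restart is
carried by `capital_add`, `hazard_add`, `povertyTime_of_gt` and `discountedPenalty_of_gt`; the law
of the noise after the first loss by `lintegral_noiseLaw`; the density of the killing time by
`lintegral_exp_hittingLevel`; the memoryless step by `lintegral_expMeasure_one_sub`. Together they
give `meanPenalty_eq`.

The drift is bounded below by a positive constant, so each flow line is an increasing bijection of
the real line and time can be replaced by the capital level `v`, with Jacobian `1 / drift v`. On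
each region the travel time is a logarithm, so the discount factor is a power (the `growthDiscount`
lemmas), and discount factors multiply across `x*` and `B`. The functions `𝒜` and `𝒞` are both the
integral of `m (v z)` against `G`, cut at different points. Everything is an identity between lower
integrals in `[0, ∞]`, so neither finiteness of `m` nor uniqueness for the renewal equation is
needed. -/

theorem exists_drift_ge (M : CapitalModel) : ∃ d, 0 < d ∧ ∀ u, d ≤ M.drift u := by
  obtain ⟨r, c, a, B, hr, hc, ha, haB⟩ := M
  refine ⟨min (r * ((B - a) / 2)) (c * ((B - a) / 2)), lt_min (by nlinarith) (by nlinarith),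
    fun u => ?_⟩
  simp only [drift]
  have h1 : 0 ≤ r * max (u - a) 0 := mul_nonneg hr.le (le_max_right _ _)
  have h2 : 0 ≤ c * max (B - u) 0 := mul_nonneg hc.le (le_max_right _ _)
  -- Below the midpoint of `[x*, B]` the transfer term alone gives the bound, above it the growth
  -- term does.
  rcases le_total u ((a + B) / 2) with h | h
  · have : c * ((B - a) / 2) ≤ c * max (B - u) 0 :=
      mul_le_mul_of_nonneg_left (le_max_of_le_left (by linarith)) hc.le
    exact (min_le_right _ _).trans (by linarith)
  · have : r * ((B - a) / 2) ≤ r * max (u - a) 0 :=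
      mul_le_mul_of_nonneg_left (le_max_of_le_left (by linarith)) hr.le
    exact (min_le_left _ _).trans (by linarith)

theorem drift_pos (M : CapitalModel) (u : ℝ) : 0 < M.drift u := by
  obtain ⟨d, hd, h⟩ := M.exists_drift_ge
  exact hd.trans_le (h u)

theorem exists_lipschitzWith_drift (M : CapitalModel) : ∃ K, LipschitzWith K M.drift := by
  have h1 : LipschitzWith (1 + 0) (fun u : ℝ => u - M.xStar) := by
    simpa only [sub_eq_add_neg, id] using! LipschitzWith.id.add (LipschitzWith.const (-M.xStar))
  have h2 : LipschitzWith (0 + 1) (fun u : ℝ => M.B - u) :=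
    (LipschitzWith.const M.B).sub LipschitzWith.id
  exact ⟨_, ((lipschitzWith_smul M.r).comp (h1.max_const 0)).add
    ((lipschitzWith_smul M.cT).comp (h2.max_const 0))⟩

theorem hasDerivAt_flow (M : CapitalModel) (x t : ℝ) :
    HasDerivAt (M.flow x) (M.drift (M.flow x t)) t := (M.flow_spec x).2 t

@[simp] theorem flow_zero (M : CapitalModel) (x : ℝ) : M.flow x 0 = x := (M.flow_spec x).1

theorem continuous_flow (M : CapitalModel) (x : ℝ) : Continuous (M.flow x) :=
  continuous_iff_continuousAt.2 fun t => (M.hasDerivAt_flow x t).continuousAt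

theorem strictMono_flow (M : CapitalModel) (x : ℝ) : StrictMono (M.flow x) :=
  strictMono_of_deriv_pos fun t => by
    rw [(M.hasDerivAt_flow x t).deriv]; exact M.drift_pos _

theorem eq_flow (M : CapitalModel) {φ : ℝ → ℝ} (h : ∀ t, HasDerivAt φ (M.drift (φ t)) t) :
    φ = M.flow (φ 0) := by
  obtain ⟨K, hK⟩ := M.exists_lipschitzWith_drift
  exact ODE_solution_unique_univ (v := fun _ => M.drift) (s := fun _ => univ) (t₀ := 0) (K := K)
    (fun _ => hK.lipschitzOnWith) (fun t => ⟨h t, trivial⟩)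
    (fun t => ⟨M.hasDerivAt_flow _ t, trivial⟩) (by simp)

theorem flow_flow (M : CapitalModel) (x s t : ℝ) : M.flow (M.flow x s) t = M.flow x (s + t) := by
  have := M.eq_flow (φ := fun t => M.flow x (s + t)) fun t => by
    simpa using (M.hasDerivAt_flow x (s + t)).comp_const_add s t
  simp only [add_zero] at this
  exact (congrFun this t).symm

/-- With `d` a positive lower bound of the drift, `flow x t - d t` is monotone, so the flow
dominates a line of slope `d` forwards and lies below it backwards. -/
theorem surjective_flow (M : CapitalModel) (x : ℝ) : Function.Surjective (M.flow x) := by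
  obtain ⟨d, hd, h⟩ := M.exists_drift_ge
  have hder (t : ℝ) : HasDerivAt (fun t => M.flow x t - d * t) (M.drift (M.flow x t) - d * 1) t :=
    (M.hasDerivAt_flow x t).sub ((hasDerivAt_id t).const_mul d)
  have hmono : Monotone fun t => M.flow x t - d * t := by
    refine monotone_of_deriv_nonneg ?_ ?_
    · exact fun t => (hder t).differentiableAt
    · intro t
      rw [(hder t).deriv]
      simpa using h _
  refine (M.continuous_flow x).surjective ?_ ?_
  · refine tendsto_atTop_mono' atTop (f₁ := fun t => x + d * t) ?_
      (tendsto_atTop_add_const_left _ _ (tendsto_id.const_mul_atTop hd))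
    filter_upwards [eventually_ge_atTop 0] with t ht
    have := hmono ht
    simp at this; linarith
  · refine tendsto_atBot_mono' atBot (f₁ := fun t => x + d * t) ?_
      (tendsto_atBot_add_const_left _ _ (tendsto_id.const_mul_atBot hd))
    filter_upwards [eventually_le_atBot 0] with t ht
    have := hmono ht
    simp at this; linarith

/-- The flow line through `0`, as an order isomorphism. -/
noncomputable def flowIso (M : CapitalModel) : ℝ ≃o ℝ :=
  (M.strictMono_flow 0).orderIsoOfSurjective _ (M.surjective_flow 0)

/-- The time at which the flow line through `0` reaches the level `u`. -/
noncomputable def age (M : CapitalModel) (u : ℝ) : ℝ := M.flowIso.symm u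

theorem flow_age (M : CapitalModel) (u : ℝ) : M.flow 0 (M.age u) = u :=
  M.flowIso.apply_symm_apply u

theorem age_flow_zero (M : CapitalModel) (t : ℝ) : M.age (M.flow 0 t) = t :=
  M.flowIso.symm_apply_apply t

/-- The equation is autonomous and the line through `0` meets every level, so all flow lines are
time translates of that one. In the coordinate `age` the flow is translation; this also yields joint
continuity of a flow that was selected by choice for each starting point. -/
theorem flow_eq (M : CapitalModel) (x t : ℝ) : M.flow x t = M.flow 0 (M.age x + t) := by
  rw [← M.flow_flow, M.flow_age]

theorem age_flow (M : CapitalModel) (x t : ℝ) : M.age (M.flow x t) = M.age x + t := by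
  rw [M.flow_eq, M.age_flow_zero]

theorem flow_age_sub (M : CapitalModel) (x v : ℝ) : M.flow x (M.age v - M.age x) = v := by
  rw [M.flow_eq, add_sub_cancel, M.flow_age]

theorem strictMono_age (M : CapitalModel) : StrictMono M.age := M.flowIso.symm.strictMono

theorem continuous_age (M : CapitalModel) : Continuous M.age := M.flowIso.symm.continuous

theorem hasDerivAt_age (M : CapitalModel) (u : ℝ) : HasDerivAt M.age (1 / M.drift u) u := by
  rw [one_div]
  refine HasDerivAt.of_local_left_inverse (f := M.flow 0) M.continuous_age.continuousAt ?_
    (M.drift_pos u).ne' (Eventually.of_forall M.flow_age)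
  simpa only [M.flow_age] using M.hasDerivAt_flow 0 (M.age u)

theorem continuous_uncurry_flow (M : CapitalModel) :
    Continuous fun p : ℝ × ℝ => M.flow p.1 p.2 := by
  have : (fun p : ℝ × ℝ => M.flow p.1 p.2) = fun p => M.flow 0 (M.age p.1 + p.2) := by
    ext p; exact M.flow_eq _ _
  rw [this]
  have h1 := M.continuous_age
  have h2 := M.continuous_flow 0
  fun_prop

theorem le_flow (M : CapitalModel) (x : ℝ) {t : ℝ} (ht : 0 ≤ t) : x ≤ M.flow x t := by
  simpa using (M.strictMono_flow x).monotone ht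

/-- The substitution `t = age v - age x`, which turns integrals over time into integrals over
capital levels. -/
theorem lintegral_age_image (M : CapitalModel) (x : ℝ) {S : Set ℝ} (hS : MeasurableSet S)
    (g : ℝ → ℝ≥0∞) :
    ∫⁻ t in (fun v => M.age v - M.age x) '' S, g t =
      ∫⁻ v in S, ENNReal.ofReal (1 / M.drift v) * g (M.age v - M.age x) := by
  rw [lintegral_image_eq_lintegral_abs_deriv_mul hS
    (fun v _ => ((M.hasDerivAt_age v).sub_const (M.age x)).hasDerivWithinAt)]
  · simp_rw [abs_of_pos (one_div_pos.2 (M.drift_pos _))]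
  · exact fun u _ v _ h => M.strictMono_age.injective (by simpa using h)

theorem lintegral_Ioi_age (M : CapitalModel) (x : ℝ) (g : ℝ → ℝ≥0∞) :
    ∫⁻ t in Ioi 0, g t =
      ∫⁻ v in Ioi x, ENNReal.ofReal (1 / M.drift v) * g (M.age v - M.age x) := by
  rw [← M.lintegral_age_image x measurableSet_Ioi]
  congr 2
  ext t
  simp only [mem_Ioi, mem_image]
  constructor
  · intro ht
    exact ⟨M.flow x t, by simpa using M.strictMono_flow x ht, by rw [M.age_flow]; ring⟩
  · rintro ⟨v, hv, rfl⟩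
    simpa using M.strictMono_age hv

theorem lintegral_Ioo_age (M : CapitalModel) (x y : ℝ) (g : ℝ → ℝ≥0∞) :
    ∫⁻ t in Ioo 0 (M.age y - M.age x), g t =
      ∫⁻ v in Ioo x y, ENNReal.ofReal (1 / M.drift v) * g (M.age v - M.age x) := by
  rw [← M.lintegral_age_image x measurableSet_Ioo]
  congr 2
  ext t
  simp only [mem_Ioo, mem_image]
  constructor
  · rintro ⟨h1, h2⟩
    refine ⟨M.flow x t, ⟨by simpa using M.strictMono_flow x h1, ?_⟩, by rw [M.age_flow]; ring⟩
    simpa [M.flow_age_sub] using M.strictMono_flow x h2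
  · rintro ⟨v, hv, rfl⟩
    have := M.strictMono_age hv.1
    have := M.strictMono_age hv.2
    constructor <;> linarith

/-- The accumulated extreme poverty rate up to time `t` of a household which suffers no loss. -/
noncomputable def flowHazard (M : CapitalModel) (rate : ℝ → ℝ≥0) (x t : ℝ) : ℝ≥0∞ :=
  ∫⁻ s in Icc 0 t, if M.flow x s < M.xStar then (rate (M.flow x s) : ℝ≥0∞) else 0

theorem flowHazard_age_sub (M : CapitalModel) (rate : ℝ → ℝ≥0) (x y : ℝ) :
    M.flowHazard rate x (M.age y - M.age x) =
      ∫⁻ v in Ioo x y, ENNReal.ofReal (1 / M.drift v) *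
        if v < M.xStar then (rate v : ℝ≥0∞) else 0 := by
  rw [flowHazard, ← setLIntegral_congr Ioo_ae_eq_Icc, M.lintegral_Ioo_age]
  simp only [M.flow_age_sub]

/-- Only the passage through levels below `x*` counts, and the speed there is at least `d`, so the
hazard is at most `1 / d` times the integral of the rate. -/
theorem flowHazard_lt_top (M : CapitalModel) {rate : ℝ → ℝ≥0} {x : ℝ}
    (h : IntegrableOn (fun u => (rate u : ℝ)) (Ico x M.xStar)) (t : ℝ) :
    M.flowHazard rate x t < ∞ := by
  obtain ⟨d, hd, hle⟩ := M.exists_drift_ge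
  have ht : t = M.age (M.flow x t) - M.age x := by rw [M.age_flow]; ring
  rw [ht, M.flowHazard_age_sub]
  calc _ ≤ ∫⁻ v in Ioi x, ENNReal.ofReal (1 / d) *
        (Iio M.xStar).indicator (fun v => (rate v : ℝ≥0∞)) v := by
        refine (lintegral_mono_set Ioo_subset_Ioi_self).trans (lintegral_mono fun v => ?_)
        gcongr
        · exact hle v
        · simp [indicator]
    _ = ENNReal.ofReal (1 / d) * ∫⁻ v in Ioo x M.xStar, (rate v : ℝ≥0∞) := by
        rw [lintegral_const_mul' _ _ ENNReal.ofReal_ne_top, lintegral_indicator measurableSet_Iio,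
          Measure.restrict_restrict measurableSet_Iio, Iio_inter_Ioi]
    _ < ∞ := by
        refine ENNReal.mul_lt_top ENNReal.ofReal_lt_top ?_
        have h2 := (h.mono_set Ioo_subset_Ico_self).hasFiniteIntegral
        simpa [HasFiniteIntegral] using h2

end CapitalModel

/-! ### First passage of a primitive through a level. -/

/-- The first time at which the function `H` reaches the level `y`, possibly `∞`. -/
noncomputable def hittingLevel (H : ℝ → ℝ≥0∞) (y : ℝ) : ℝ≥0∞ :=
  ⨅ (t : ℝ≥0) (_ : ENNReal.ofReal y ≤ H t), (t : ℝ≥0∞)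

theorem hittingLevel_le {H : ℝ → ℝ≥0∞} {y t : ℝ} (ht : 0 ≤ t) (h : ENNReal.ofReal y ≤ H t) :
    hittingLevel H y ≤ ENNReal.ofReal t :=
  iInf₂_le (⟨t, ht⟩ : ℝ≥0) h |>.trans_eq (ENNReal.ofReal_eq_coe_nnreal ht).symm

theorem exists_of_hittingLevel_lt {H : ℝ → ℝ≥0∞} {y t : ℝ}
    (h : hittingLevel H y < ENNReal.ofReal t) : ∃ s, 0 ≤ s ∧ s < t ∧ ENNReal.ofReal y ≤ H s := by
  simp only [hittingLevel, iInf_lt_iff] at h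
  obtain ⟨s, hs, hst⟩ := h
  refine ⟨s, s.2, ?_, hs⟩
  rw [← ENNReal.ofReal_coe_nnreal] at hst
  exact (ENNReal.ofReal_lt_ofReal_iff_of_nonneg s.2).1 hst

theorem monotone_hittingLevel (H : ℝ → ℝ≥0∞) : Monotone (hittingLevel H) := fun _ _ hab =>
  le_iInf₂ fun t ht => iInf₂_le t ((ENNReal.ofReal_le_ofReal hab).trans ht)

theorem monotone_lintegral_Icc (g : ℝ → ℝ≥0∞) : Monotone fun t => ∫⁻ s in Icc 0 t, g s :=
  fun _ _ hab => lintegral_mono_set (Icc_subset_Icc_right hab)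

theorem continuous_lintegral_Icc {g : ℝ → ℝ≥0∞} (hg : Measurable g)
    (hfin : ∀ t, ∫⁻ s in Icc 0 t, g s ≠ ∞) : Continuous fun t => ∫⁻ s in Icc 0 t, g s := by
  have hint (t : ℝ) : IntegrableOn (fun s => (g s).toReal) (Icc 0 t) :=
    integrable_toReal_of_lintegral_ne_top hg.aemeasurable (hfin t)
  -- Extending by `0` to negative times, together with `max t 0` below, matches the emptiness of
  -- `Icc 0 t` for `t < 0`.
  let G : ℝ → ℝ := (Ici 0).indicator fun s => (g s).toReal
  have hG (a b : ℝ) : IntervalIntegrable G volume a b := by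
    have h1 (a b : ℝ) : IntegrableOn G (Ioc a b) := by
      rw [IntegrableOn, integrable_indicator_iff measurableSet_Ici, IntegrableOn,
        Measure.restrict_restrict measurableSet_Ici]
      exact (hint b).mono_set fun s hs => ⟨hs.1, hs.2.2⟩
    exact ⟨h1 a b, h1 b a⟩
  have heq : (fun t => ∫⁻ s in Icc 0 t, g s) =
      fun t => ENNReal.ofReal (∫ s in (0 : ℝ)..max t 0, G s) := by
    ext t
    rcases lt_or_ge t 0 with ht | ht
    · simp [Icc_eq_empty (not_le.2 ht), max_eq_right ht.le]
    · rw [max_eq_left ht, intervalIntegral.integral_of_le ht, ← integral_Icc_eq_integral_Ioc,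
        setIntegral_congr_fun (g := fun s => (g s).toReal) measurableSet_Icc
          (fun s hs => indicator_of_mem (show s ∈ Ici 0 from hs.1) _),
        integral_toReal hg.aemeasurable (ae_lt_top hg (hfin t)), ENNReal.ofReal_toReal (hfin t)]
  rw [heq]
  exact ENNReal.continuous_ofReal.comp
    ((intervalIntegral.continuous_primitive hG 0).comp (by fun_prop))

theorem lintegral_Icc_zero (g : ℝ → ℝ≥0∞) : ∫⁻ s in Icc 0 (0 : ℝ), g s = 0 := by simp

/-- Right continuity of the primitive makes the infimum attained. -/
theorem hittingLevel_le_iff {g : ℝ → ℝ≥0∞} (hg : Measurable g)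
    (hfin : ∀ t, ∫⁻ s in Icc 0 t, g s ≠ ∞) {y t : ℝ} (ht : 0 ≤ t) :
    hittingLevel (fun t => ∫⁻ s in Icc 0 t, g s) y ≤ ENNReal.ofReal t ↔
      ENNReal.ofReal y ≤ ∫⁻ s in Icc 0 t, g s := by
  refine ⟨fun h => ?_, hittingLevel_le (H := fun t => ∫⁻ s in Icc 0 t, g s) ht⟩
  have hc := (continuous_lintegral_Icc hg hfin).continuousWithinAt (s := Ioi t) (x := t)
  refine ge_of_tendsto hc ?_
  filter_upwards [self_mem_nhdsWithin] with u (hu : t < u)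
  obtain ⟨s, -, hsu, hs⟩ := exists_of_hittingLevel_lt
    (h.trans_lt ((ENNReal.ofReal_lt_ofReal_iff (ht.trans_lt hu)).2 hu))
  exact hs.trans (monotone_lintegral_Icc g hsu.le)

theorem hittingLevel_pos {g : ℝ → ℝ≥0∞} (hg : Measurable g)
    (hfin : ∀ t, ∫⁻ s in Icc 0 t, g s ≠ ∞) {y : ℝ} (hy : 0 < y) :
    0 < hittingLevel (fun t => ∫⁻ s in Icc 0 t, g s) y := by
  rw [pos_iff_ne_zero]
  intro h
  have := (hittingLevel_le_iff hg hfin (y := y) le_rfl).1 (by simp [h])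
  rw [lintegral_Icc_zero] at this
  simp at this
  linarith

/-- Left continuity prevents the primitive from overshooting the level. Positivity of `y` makes the
hitting time positive, so that there are nonnegative times to its left. -/
theorem lintegral_Icc_hittingLevel {g : ℝ → ℝ≥0∞} (hg : Measurable g)
    (hfin : ∀ t, ∫⁻ s in Icc 0 t, g s ≠ ∞) {y : ℝ} (hy : 0 < y)
    (h : hittingLevel (fun t => ∫⁻ s in Icc 0 t, g s) y ≠ ∞) :
    ∫⁻ s in Icc 0 (hittingLevel (fun t => ∫⁻ s in Icc 0 t, g s) y).toReal, g s =
      ENNReal.ofReal y := by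
  set τ := hittingLevel (fun t => ∫⁻ s in Icc 0 t, g s) y with hτ
  have hpos : 0 < τ.toReal := ENNReal.toReal_pos (hittingLevel_pos hg hfin hy).ne' h
  refine le_antisymm ?_ ?_
  · have hc := (continuous_lintegral_Icc hg hfin).continuousWithinAt (s := Iio τ.toReal)
      (x := τ.toReal)
    refine le_of_tendsto hc ?_
    filter_upwards [Ico_mem_nhdsLT hpos] with u hu
    refine le_of_not_ge fun hle => ?_
    have h1 := (hittingLevel_le_iff hg hfin hu.1).2 hle
    have := ENNReal.toReal_mono ENNReal.ofReal_ne_top h1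
    rw [ENNReal.toReal_ofReal hu.1] at this
    exact absurd hu.2 (not_lt.2 this)
  · exact (hittingLevel_le_iff hg hfin ENNReal.toReal_nonneg).1 (ENNReal.ofReal_toReal h).ge

/-- The hitting time is a generalised inverse of the primitive `H`: for `t ≥ 0`, the levels `y > 0`
reached by time `t` form `(0, H t]`, of length `H t`. Comparing masses of half-lines avoids any
differentiation of `H`. -/
theorem map_hittingLevel {g : ℝ → ℝ≥0∞} (hg : Measurable g)
    (hfin : ∀ t, ∫⁻ s in Icc 0 t, g s ≠ ∞) :
    (volume.restrict {y | 0 < y ∧ hittingLevel (fun t => ∫⁻ s in Icc 0 t, g s) y ≠ ∞}).map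
      (fun y => (hittingLevel (fun t => ∫⁻ s in Icc 0 t, g s) y).toReal) =
    (volume.restrict (Ioi 0)).withDensity g := by
  set τ := hittingLevel (fun t => ∫⁻ s in Icc 0 t, g s) with hτ
  have hτm : Measurable τ := (monotone_hittingLevel _).measurable
  have h2 (t : ℝ) : (volume.restrict (Ioi 0)).withDensity g (Iic t) = ∫⁻ s in Icc 0 t, g s := by
    rw [withDensity_apply _ measurableSet_Iic, Measure.restrict_restrict measurableSet_Iic,
      inter_comm, Ioi_inter_Iic]
    exact setLIntegral_congr Ioc_ae_eq_Icc
  have h1 (t : ℝ) : (volume.restrict {y | 0 < y ∧ τ y ≠ ∞}).map (fun y => (τ y).toReal) (Iic t) =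
      ∫⁻ s in Icc 0 t, g s := by
    rw [Measure.map_apply hτm.ennreal_toReal measurableSet_Iic,
      Measure.restrict_apply (hτm.ennreal_toReal measurableSet_Iic)]
    rcases lt_or_ge t 0 with ht | ht
    · rw [Icc_eq_empty (not_le.2 ht), Measure.restrict_empty, lintegral_zero_measure]
      convert measure_empty (μ := volume)
      ext y
      simp only [mem_inter_iff, mem_preimage, mem_Iic, mem_empty_iff_false, iff_false, not_and]
      exact fun h => absurd (ENNReal.toReal_nonneg.trans h) (not_le.2 ht)
    · have : (fun y => (τ y).toReal) ⁻¹' Iic t ∩ {y | 0 < y ∧ τ y ≠ ∞} =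
          Ioc 0 (∫⁻ s in Icc 0 t, g s).toReal := by
        ext y
        simp only [mem_inter_iff, mem_preimage, mem_Iic, mem_ofPred_eq, mem_Ioc]
        constructor
        · rintro ⟨h, hy, hf⟩
          refine ⟨hy, (ENNReal.ofReal_le_iff_le_toReal (hfin t)).1
            ((hittingLevel_le_iff hg hfin ht).1 ((ENNReal.le_ofReal_iff_toReal_le hf ht).2 h))⟩
        · rintro ⟨hy, h⟩
          have h3 := (hittingLevel_le_iff hg hfin ht).2
            ((ENNReal.ofReal_le_iff_le_toReal (hfin t)).2 h)
          have h4 : τ y ≠ ∞ := ne_top_of_le_ne_top ENNReal.ofReal_ne_top h3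
          exact ⟨(ENNReal.le_ofReal_iff_toReal_le h4 ht).1 h3, hy, h4⟩
      rw [this, Real.volume_Ioc, sub_zero, ENNReal.ofReal_toReal (hfin t)]
  have : IsLocallyFiniteMeasure ((volume.restrict {y | 0 < y ∧ τ y ≠ ∞}).map
      fun y => (τ y).toReal) :=
    ⟨fun x => ⟨Iic (x + 1), Iic_mem_nhds (lt_add_one x), by rw [h1]; exact (hfin _).lt_top⟩⟩
  refine Measure.ext_of_Ioc _ _ fun a b hab => ?_
  rw [← Iic_sdiff_Iic, measure_sdiff (Iic_subset_Iic.2 hab.le) measurableSet_Iic.nullMeasurableSet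
    (by rw [h1]; exact hfin _), measure_sdiff (Iic_subset_Iic.2 hab.le)
    measurableSet_Iic.nullMeasurableSet (by rw [h2]; exact hfin _)]
  simp only [h1, h2]

/-- The law of the first time at which a primitive of `g` reaches an exponential level has density
`g t * exp (- ∫₀ᵗ g)`. -/
theorem lintegral_exp_hittingLevel {g : ℝ → ℝ≥0∞} (hg : Measurable g)
    (hfin : ∀ t, ∫⁻ s in Icc 0 t, g s ≠ ∞) {F : ℝ → ℝ≥0∞} (hF : Measurable F) :
    ∫⁻ y in Ioi 0, ENNReal.ofReal (Real.exp (-y)) *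
      (if hittingLevel (fun t => ∫⁻ s in Icc 0 t, g s) y = ∞ then 0
        else F (hittingLevel (fun t => ∫⁻ s in Icc 0 t, g s) y).toReal) =
    ∫⁻ t in Ioi 0, ENNReal.ofReal (Real.exp (-(∫⁻ s in Icc 0 t, g s).toReal)) * (g t * F t) := by
  set τ := hittingLevel (fun t => ∫⁻ s in Icc 0 t, g s) with hτ
  have hτm : Measurable τ := (monotone_hittingLevel _).measurable
  have hH : Measurable fun t => ∫⁻ s in Icc 0 t, g s := (monotone_lintegral_Icc g).measurable
  have hS : MeasurableSet {y : ℝ | τ y ≠ ∞} := (hτm (measurableSet_singleton ∞)).compl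
  have hS' : MeasurableSet {y : ℝ | 0 < y ∧ τ y ≠ ∞} := measurableSet_Ioi.inter hS
  have hK : Measurable fun t =>
      ENNReal.ofReal (Real.exp (-(∫⁻ s in Icc 0 t, g s).toReal)) * F t :=
    (hH.ennreal_toReal.neg.exp.ennreal_ofReal).mul hF
  -- At the hitting time the primitive equals `y`, so `exp (-y)` becomes a function of the hitting
  -- time and the integral can be pushed forward.
  calc _ = ∫⁻ y in {y | 0 < y ∧ τ y ≠ ∞},
        ENNReal.ofReal (Real.exp (-(∫⁻ s in Icc 0 (τ y).toReal, g s).toReal)) * F (τ y).toReal := by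
        have : {y : ℝ | 0 < y ∧ τ y ≠ ∞} = {y | τ y ≠ ∞} ∩ Ioi 0 := by ext; simp [and_comm]
        rw [this, ← Measure.restrict_restrict hS, ← lintegral_indicator hS]
        refine setLIntegral_congr_fun measurableSet_Ioi fun y hy => ?_
        by_cases h : τ y = ∞
        · simp [h]
        · simp only [h, if_false, mem_ofPred_eq, ne_eq, not_false_eq_true, indicator_of_mem]
          rw [lintegral_Icc_hittingLevel hg hfin hy h, ENNReal.toReal_ofReal (le_of_lt hy)]
    _ = ∫⁻ t, ENNReal.ofReal (Real.exp (-(∫⁻ s in Icc 0 t, g s).toReal)) * F t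
          ∂((volume.restrict {y | 0 < y ∧ τ y ≠ ∞}).map fun y => (τ y).toReal) := by
        rw [lintegral_map hK hτm.ennreal_toReal]
    _ = _ := by
        rw [map_hittingLevel hg hfin, lintegral_withDensity_eq_lintegral_mul _ hg hK]
        refine lintegral_congr fun t => ?_
        simp only [Pi.mul_apply]
        ring

/-! ### Pathwise decomposition at the first loss. -/

/-- Positive waiting times without accumulation of losses. -/
def RegularTimes (T : ℕ → ℝ) : Prop :=
  (∀ n, 0 < T n) ∧ Tendsto (CapitalModel.lossTime T) atTop atTop

namespace CapitalModel

theorem lossTime_zero (T : ℕ → ℝ) : lossTime T 0 = 0 := by simp [lossTime]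

theorem lossTime_succ (T : ℕ → ℝ) (n : ℕ) : lossTime T (n + 1) = lossTime T n + T n := by
  simp [lossTime, Finset.sum_range_succ]

theorem lossTime_succ_eq_add (T : ℕ → ℝ) (n : ℕ) :
    lossTime T (n + 1) = T 0 + lossTime (fun k => T (k + 1)) n := by
  simp [lossTime, Finset.sum_range_succ', add_comm]

theorem lossTime_one (T : ℕ → ℝ) : lossTime T 1 = T 0 := by simp [lossTime]

theorem _root_.RegularTimes.strictMono {T : ℕ → ℝ} (hT : RegularTimes T) :
    StrictMono (lossTime T) :=
  strictMono_nat_of_lt_succ fun n => by rw [lossTime_succ]; linarith [hT.1 n]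

theorem _root_.RegularTimes.shift {T : ℕ → ℝ} (hT : RegularTimes T) :
    RegularTimes fun k => T (k + 1) := by
  refine ⟨fun n => hT.1 _, ?_⟩
  have h := tendsto_atTop_add_const_right atTop (-T 0) ((tendsto_add_atTop_iff_nat 1).2 hT.2)
  refine h.congr fun n => ?_
  rw [lossTime_succ_eq_add]; ring

/-- The alternative `k = 0` admits negative times, at which no loss has been counted although
`lossTime T 0 = 0` exceeds `t`. -/
theorem lossCount_eq {T : ℕ → ℝ} (hT : RegularTimes T) {k : ℕ} {t : ℝ}
    (h1 : k = 0 ∨ lossTime T k ≤ t) (h2 : t < lossTime T (k + 1)) : lossCount T t = k := by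
  have : {n : ℕ | lossTime T (n + 1) ≤ t} = Finset.range k := by
    ext n
    simp only [mem_ofPred_eq, Finset.coe_range, mem_Iio]
    constructor
    · intro h
      have := hT.strictMono.lt_iff_lt.1 (h.trans_lt h2)
      omega
    · intro h
      rcases h1 with rfl | h1
      · omega
      · exact (hT.strictMono.monotone (by omega)).trans h1
  rw [lossCount, this, ncard_coe_finset, Finset.card_range]

theorem exists_lossTime_interval {T : ℕ → ℝ} (hT : RegularTimes T) (t : ℝ) :
    ∃ k, (k = 0 ∨ lossTime T k ≤ t) ∧ t < lossTime T (k + 1) := by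
  have hex : ∃ k, t < lossTime T (k + 1) :=
    (((tendsto_add_atTop_iff_nat 1).2 hT.2).eventually_gt_atTop t).exists
  classical
  refine ⟨Nat.find hex, ?_, Nat.find_spec hex⟩
  rcases h : Nat.find hex with _ | k
  · exact Or.inl rfl
  · exact Or.inr (not_lt.1 (Nat.find_min hex (m := k) (by omega)))

/-- The intervals are closed on the right because a left limit at a loss time must see the path
before that loss. -/
theorem exists_lossTime_interval_left {T : ℕ → ℝ} (hT : RegularTimes T) (t : ℝ) :
    ∃ k, (k = 0 ∨ lossTime T k < t) ∧ t ≤ lossTime T (k + 1) := by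
  have hex : ∃ k, t ≤ lossTime T (k + 1) :=
    (((tendsto_add_atTop_iff_nat 1).2 hT.2).eventually_ge_atTop t).exists
  classical
  refine ⟨Nat.find hex, ?_, Nat.find_spec hex⟩
  rcases h : Nat.find hex with _ | k
  · exact Or.inl rfl
  · exact Or.inr (not_le.1 (Nat.find_min hex (m := k) (by omega)))

theorem capitalAtLoss_succ_shift (M : CapitalModel) (T Z : ℕ → ℝ) (x : ℝ) (n : ℕ) :
    M.capitalAtLoss T Z x (n + 1) = M.capitalAtLoss (fun k => T (k + 1)) (fun k => Z (k + 1))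
      (Z 0 * M.flow x (T 0)) n := by
  induction n with
  | zero => rfl
  | succ n ih => rw [capitalAtLoss, ih]; rfl

theorem capital_of_lt (M : CapitalModel) {T : ℕ → ℝ} (hT : RegularTimes T) (Z : ℕ → ℝ) (x : ℝ)
    {t : ℝ} (ht : t < T 0) : M.capital T Z x t = M.flow x t := by
  have : lossCount T t = 0 := lossCount_eq hT (Or.inl rfl) (by simpa [lossTime_one] using ht)
  simp [capital, this, lossTime_zero, capitalAtLoss]

/-- The restart property on a single path: after the first loss the capital is built from the
shifted noise and the capital left by that loss. -/
theorem capital_add (M : CapitalModel) {T : ℕ → ℝ} (hT : RegularTimes T) (Z : ℕ → ℝ) (x : ℝ)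
    {s : ℝ} (hs : 0 ≤ s) : M.capital T Z x (T 0 + s) =
      M.capital (fun k => T (k + 1)) (fun k => Z (k + 1)) (Z 0 * M.flow x (T 0)) s := by
  obtain ⟨k, h1, h2⟩ := exists_lossTime_interval hT.shift s
  have h3 : lossCount T (T 0 + s) = k + 1 := by
    refine lossCount_eq hT (Or.inr ?_) ?_
    · rw [lossTime_succ_eq_add]
      rcases h1 with rfl | h1
      · rw [lossTime_zero]; linarith
      · linarith
    · rw [lossTime_succ_eq_add]; linarith
  rw [capital, capital, h3, lossCount_eq hT.shift h1 h2, capitalAtLoss_succ_shift,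
    lossTime_succ_eq_add, add_sub_add_left_eq_sub]

theorem exists_tendsto_capital_left (M : CapitalModel) {T : ℕ → ℝ} (hT : RegularTimes T)
    (Z : ℕ → ℝ) (x t : ℝ) : ∃ y, Tendsto (M.capital T Z x) (𝓝[<] t) (𝓝 y) := by
  obtain ⟨k, h1, h2⟩ := exists_lossTime_interval_left hT t
  refine ⟨M.flow (M.capitalAtLoss T Z x k) (t - lossTime T k), ?_⟩
  have hc : Tendsto (fun s => M.flow (M.capitalAtLoss T Z x k) (s - lossTime T k)) (𝓝[<] t)
      (𝓝 (M.flow (M.capitalAtLoss T Z x k) (t - lossTime T k))) :=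
    (((M.continuous_flow _).comp (continuous_id.sub continuous_const)).tendsto t).mono_left
      nhdsWithin_le_nhds
  refine hc.congr' ?_
  have hev : ∀ᶠ s in 𝓝[<] t, k = 0 ∨ lossTime T k ≤ s := by
    rcases h1 with h1 | h1
    · exact Eventually.of_forall fun _ => Or.inl h1
    · filter_upwards [Ico_mem_nhdsLT h1] with s hs using Or.inr hs.1
  filter_upwards [hev, self_mem_nhdsWithin] with s hs (hst : s < t)
  rw [capital, lossCount_eq hT hs (hst.trans_le h2)]

theorem leftLim_capital_of_lt (M : CapitalModel) {T : ℕ → ℝ} (hT : RegularTimes T) (Z : ℕ → ℝ)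
    (x : ℝ) {t : ℝ} (ht : t < T 0) : Function.leftLim (M.capital T Z x) t = M.flow x t := by
  refine leftLim_eq_of_tendsto ((((M.continuous_flow x).tendsto t).mono_left
    nhdsWithin_le_nhds).congr' ?_)
  filter_upwards [self_mem_nhdsWithin] with s (hs : s < t)
  exact (M.capital_of_lt hT Z x (hs.trans ht)).symm

theorem leftLim_capital_add (M : CapitalModel) {T : ℕ → ℝ} (hT : RegularTimes T) (Z : ℕ → ℝ)
    (x : ℝ) {s : ℝ} (hs : 0 < s) : Function.leftLim (M.capital T Z x) (T 0 + s) =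
      Function.leftLim (M.capital (fun k => T (k + 1)) (fun k => Z (k + 1))
        (Z 0 * M.flow x (T 0))) s := by
  obtain ⟨y, hy⟩ := M.exists_tendsto_capital_left hT.shift (fun k => Z (k + 1))
    (Z 0 * M.flow x (T 0)) s
  rw [leftLim_eq_of_tendsto hy]
  refine leftLim_eq_of_tendsto ?_
  have h1 : Tendsto (fun u => u - T 0) (𝓝[<] (T 0 + s)) (𝓝[<] s) := by
    refine tendsto_nhdsWithin_iff.2 ⟨?_, ?_⟩
    · have : Tendsto (fun u => u - T 0) (𝓝 (T 0 + s)) (𝓝 (T 0 + s - T 0)) :=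
        (continuous_id.sub continuous_const).tendsto _
      rw [add_sub_cancel_left] at this
      exact this.mono_left nhdsWithin_le_nhds
    · filter_upwards [self_mem_nhdsWithin] with u (hu : u < T 0 + s)
      simp only [mem_Iio]; linarith
  refine (hy.comp h1).congr' ?_
  filter_upwards [Ico_mem_nhdsLT (show T 0 < T 0 + s by linarith)] with u hu
  simp only [Function.comp]
  rw [← M.capital_add hT Z x (sub_nonneg.2 hu.1), add_sub_cancel]

theorem hazard_of_le (M : CapitalModel) (rate : ℝ → ℝ≥0) {T : ℕ → ℝ} (hT : RegularTimes T)
    (Z : ℕ → ℝ) (x : ℝ) {t : ℝ} (ht : t ≤ T 0) :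
    M.hazard rate T Z x t = M.flowHazard rate x t := by
  rw [hazard, flowHazard, ← setLIntegral_congr Ico_ae_eq_Icc, ← setLIntegral_congr Ico_ae_eq_Icc]
  refine setLIntegral_congr_fun measurableSet_Ico fun s hs => ?_
  simp only [M.capital_of_lt hT Z x (hs.2.trans_le ht)]

theorem hazard_add (M : CapitalModel) (rate : ℝ → ℝ≥0) {T : ℕ → ℝ} (hT : RegularTimes T)
    (Z : ℕ → ℝ) (x : ℝ) {s : ℝ} (hs : 0 ≤ s) :
    M.hazard rate T Z x (T 0 + s) = M.flowHazard rate x (T 0) +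
      M.hazard rate (fun k => T (k + 1)) (fun k => Z (k + 1)) (Z 0 * M.flow x (T 0)) s := by
  have h0 := (hT.1 0).le
  -- The jump time is assigned to the second piece; changing the first piece at that one point does
  -- not affect its integral.
  have hU : Icc 0 (T 0 + s) = Ico 0 (T 0) ∪ Icc (T 0) (T 0 + s) :=
    (Ico_union_Icc_eq_Icc h0 (by linarith)).symm
  rw [hazard, hU, lintegral_union measurableSet_Icc
    (Set.disjoint_left.2 fun u hu hu' => absurd hu.2 (not_lt.2 hu'.1)),
    setLIntegral_congr Ico_ae_eq_Icc]
  congr 1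
  · exact M.hazard_of_le rate hT Z x le_rfl
  · rw [hazard]
    have hpre : (fun u : ℝ => T 0 + u) ⁻¹' Icc (T 0) (T 0 + s) = Icc 0 s := by
      ext u; simp
    have := (measurePreserving_add_left volume (T 0)).setLIntegral_comp_preimage_emb
      (measurableEmbedding_addLeft (T 0)) (fun u => if M.capital T Z x u < M.xStar
        then (rate (M.capital T Z x u) : ℝ≥0∞) else 0) (Icc (T 0) (T 0 + s))
    rw [← this, hpre]
    refine setLIntegral_congr_fun measurableSet_Icc fun u hu => ?_
    simp only [M.capital_add hT Z x hu.1]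

theorem monotone_hazard (M : CapitalModel) (rate : ℝ → ℝ≥0) (T Z : ℕ → ℝ) (x : ℝ) :
    Monotone (M.hazard rate T Z x) := monotone_lintegral_Icc _

theorem monotone_flowHazard (M : CapitalModel) (rate : ℝ → ℝ≥0) (x : ℝ) :
    Monotone (M.flowHazard rate x) := monotone_lintegral_Icc _

theorem povertyTime_of_lt (M : CapitalModel) (rate : ℝ → ℝ≥0) {T : ℕ → ℝ} (hT : RegularTimes T)
    (Z : ℕ → ℝ) {e x : ℝ} (h : hittingLevel (M.flowHazard rate x) e < ENNReal.ofReal (T 0)) :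
    M.povertyTime rate T Z e x = hittingLevel (M.flowHazard rate x) e := by
  have hle : ∀ {t : ℝ}, t ≤ T 0 → M.hazard rate T Z x t = M.flowHazard rate x t :=
    fun ht => M.hazard_of_le rate hT Z x ht
  refine le_antisymm ?_ ?_
  · refine le_iInf₂ fun t ht => ?_
    rcases le_total (t : ℝ) (T 0) with h1 | h1
    · exact iInf₂_le t (by rwa [hle h1])
    · obtain ⟨s, hs0, hs, hes⟩ := exists_of_hittingLevel_lt h
      refine (iInf₂_le (⟨s, hs0⟩ : ℝ≥0) (by rw [← hle hs.le] at hes; exact hes)).trans ?_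
      exact ENNReal.coe_le_coe.2 (hs.trans_le h1).le
  · refine le_iInf₂ fun t ht => ?_
    rcases le_total (t : ℝ) (T 0) with h1 | h1
    · exact iInf₂_le t (by rwa [← hle h1])
    · refine h.le.trans ?_
      rw [← ENNReal.ofReal_coe_nnreal]
      exact ENNReal.ofReal_le_ofReal h1

theorem flowHazard_lt_of_lt_hittingLevel (M : CapitalModel) {rate : ℝ → ℝ≥0} {x e t : ℝ}
    (ht : 0 ≤ t) (h : ENNReal.ofReal t < hittingLevel (M.flowHazard rate x) e) :
    M.flowHazard rate x t < ENNReal.ofReal e :=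
  lt_of_not_ge fun hle => absurd (hittingLevel_le ht hle) (not_le.2 h)

/-- Part of the level `e` has been used up by the first loss, so the restarted path has to reach
only the remainder. The tie between the loss and the hitting time is left out here and later
discarded as a null event. -/
theorem povertyTime_of_gt (M : CapitalModel) (rate : ℝ → ℝ≥0) {T : ℕ → ℝ} (hT : RegularTimes T)
    (Z : ℕ → ℝ) {e x : ℝ} (h : ENNReal.ofReal (T 0) < hittingLevel (M.flowHazard rate x) e) :
    M.povertyTime rate T Z e x = ENNReal.ofReal (T 0) +
      M.povertyTime rate (fun k => T (k + 1)) (fun k => Z (k + 1))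
        (e - (M.flowHazard rate x (T 0)).toReal) (Z 0 * M.flow x (T 0)) := by
  have h0 := (hT.1 0).le
  have hlt := M.flowHazard_lt_of_lt_hittingLevel h0 h
  have hfin : M.flowHazard rate x (T 0) ≠ ∞ := hlt.ne_top
  have hlt' : (M.flowHazard rate x (T 0)).toReal < e := ENNReal.toReal_lt_of_lt_ofReal hlt
  have key (s : ℝ) (hs : 0 ≤ s) : ENNReal.ofReal e ≤ M.hazard rate T Z x (T 0 + s) ↔
      ENNReal.ofReal (e - (M.flowHazard rate x (T 0)).toReal) ≤
        M.hazard rate (fun k => T (k + 1)) (fun k => Z (k + 1)) (Z 0 * M.flow x (T 0)) s := by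
    rw [M.hazard_add rate hT Z x hs, ENNReal.ofReal_sub _ ENNReal.toReal_nonneg,
      ENNReal.ofReal_toReal hfin, tsub_le_iff_left]
  refine le_antisymm ?_ ?_
  · conv_rhs => rw [povertyTime]
    rw [ENNReal.add_iInf₂]
    refine le_iInf₂ fun s hs => ?_
    refine (hittingLevel_le (add_nonneg h0 s.coe_nonneg) ((key s s.coe_nonneg).2 hs)).trans ?_
    rw [ENNReal.ofReal_add h0 s.coe_nonneg, ENNReal.ofReal_coe_nnreal]
  · refine le_iInf₂ fun t ht => ?_
    have h1 : T 0 ≤ t := by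
      by_contra! hlt1
      rw [M.hazard_of_le rate hT Z x hlt1.le] at ht
      exact absurd (ht.trans (M.monotone_flowHazard rate x hlt1.le)) (not_le.2 hlt)
    have h2 := hittingLevel_le (sub_nonneg.2 h1) ((key (t - T 0) (sub_nonneg.2 h1)).1
      (by rwa [add_sub_cancel]))
    calc _ ≤ ENNReal.ofReal (T 0) + ENNReal.ofReal (t - T 0) := by gcongr; exact h2
      _ = t := by
        rw [← ENNReal.ofReal_add h0 (sub_nonneg.2 h1), add_sub_cancel, ENNReal.ofReal_coe_nnreal]

theorem discountedPenalty_of_lt (M : CapitalModel) (rate : ℝ → ℝ≥0) (w : ℝ → ℝ → ℝ≥0) (δ : ℝ)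
    {T : ℕ → ℝ} (hT : RegularTimes T) (Z : ℕ → ℝ) {e x : ℝ}
    (h : hittingLevel (M.flowHazard rate x) e < ENNReal.ofReal (T 0)) :
    M.discountedPenalty rate w δ T Z e x =
      w (M.flow x (hittingLevel (M.flowHazard rate x) e).toReal)
        |M.flow x (hittingLevel (M.flowHazard rate x) e).toReal - M.xStar| *
      ENNReal.ofReal (Real.exp (-δ * (hittingLevel (M.flowHazard rate x) e).toReal)) := by
  have hlt : (hittingLevel (M.flowHazard rate x) e).toReal < T 0 :=
    ENNReal.toReal_lt_of_lt_ofReal h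
  rw [discountedPenalty]
  simp only [M.povertyTime_of_lt rate hT Z h, h.ne_top, if_false, M.capital_of_lt hT Z x hlt,
    M.leftLim_capital_of_lt hT Z x hlt]

theorem discountedPenalty_of_gt (M : CapitalModel) {rate : ℝ → ℝ≥0} (hrate : Measurable rate)
    (w : ℝ → ℝ → ℝ≥0) (δ : ℝ)
    {T : ℕ → ℝ} (hT : RegularTimes T) (Z : ℕ → ℝ) {e x : ℝ}
    (h : ENNReal.ofReal (T 0) < hittingLevel (M.flowHazard rate x) e)
    (hfin : ∀ t, M.flowHazard rate (Z 0 * M.flow x (T 0)) t ≠ ∞) :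
    M.discountedPenalty rate w δ T Z e x = ENNReal.ofReal (Real.exp (-δ * T 0)) *
      M.discountedPenalty rate w δ (fun k => T (k + 1)) (fun k => Z (k + 1))
        (e - (M.flowHazard rate x (T 0)).toReal) (Z 0 * M.flow x (T 0)) := by
  have h0 := (hT.1 0).le
  have he : 0 < e - (M.flowHazard rate x (T 0)).toReal :=
    sub_pos.2 (ENNReal.toReal_lt_of_lt_ofReal (M.flowHazard_lt_of_lt_hittingLevel h0 h))
  set τ := M.povertyTime rate (fun k => T (k + 1)) (fun k => Z (k + 1))
    (e - (M.flowHazard rate x (T 0)).toReal) (Z 0 * M.flow x (T 0)) with hτ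
  -- At `s = 0` the left limit of the original path is the capital before the loss, which the
  -- restarted path does not see. Finite hazard after the loss rules this out: the remaining level
  -- is positive, so it is not reached immediately.
  have hpos : 0 < τ := by
    have hg : Measurable fun s => if M.flow (Z 0 * M.flow x (T 0)) s < M.xStar
        then (rate (M.flow (Z 0 * M.flow x (T 0)) s) : ℝ≥0∞) else 0 := by
      have hc := (M.continuous_flow (Z 0 * M.flow x (T 0))).measurable
      exact Measurable.ite (measurableSet_lt hc measurable_const)
        (hrate.comp hc).coe_nnreal_ennreal measurable_const
    rcases lt_or_ge (hittingLevel (M.flowHazard rate (Z 0 * M.flow x (T 0)))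
        (e - (M.flowHazard rate x (T 0)).toReal)) (ENNReal.ofReal (T 1)) with h1 | h1
    · rw [hτ, M.povertyTime_of_lt rate hT.shift _ h1]
      exact hittingLevel_pos hg hfin he
    · refine (ENNReal.ofReal_pos.2 (hT.1 1)).trans_le (le_iInf₂ fun t ht => ?_)
      by_contra! hlt
      rw [← ENNReal.ofReal_coe_nnreal, ENNReal.ofReal_lt_ofReal_iff (hT.1 1)] at hlt
      rw [M.hazard_of_le rate hT.shift _ _ hlt.le] at ht
      refine absurd ((hittingLevel_le t.coe_nonneg ht).trans_lt ?_) (not_lt.2 h1)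
      exact (ENNReal.ofReal_lt_ofReal_iff (hT.1 1)).2 hlt
  rw [discountedPenalty, discountedPenalty, M.povertyTime_of_gt rate hT Z h, ← hτ]
  by_cases hinf : τ = ∞
  · simp [hinf]
  · have hsum : ENNReal.ofReal (T 0) + τ ≠ ∞ := ENNReal.add_ne_top.2 ⟨ENNReal.ofReal_ne_top, hinf⟩
    simp only [hsum, hinf, if_false]
    rw [ENNReal.toReal_add ENNReal.ofReal_ne_top hinf, ENNReal.toReal_ofReal h0,
      M.leftLim_capital_add hT Z x (ENNReal.toReal_pos hpos.ne' hinf),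
      M.capital_add hT Z x ENNReal.toReal_nonneg, mul_add, Real.exp_add,
      ENNReal.ofReal_mul (Real.exp_pos _).le]
    ring

end CapitalModel

/-! ### Joint measurability of the path functionals. -/

/-- Since `H a` is monotone, a time below `b` at which the level is reached can be increased to a
rational one, so the event is a countable union. -/
theorem measurable_hittingLevel {α : Type*} [MeasurableSpace α] {H : α → ℝ → ℝ≥0∞}
    (hH : Measurable fun p : α × ℝ => H p.1 p.2) (hmono : ∀ a, Monotone (H a)) {y : α → ℝ}
    (hy : Measurable y) : Measurable fun a => hittingLevel (H a) (y a) := by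
  refine measurable_of_Iio fun b => ?_
  have : (fun a => hittingLevel (H a) (y a)) ⁻¹' Iio b =
      ⋃ q : ℚ, if 0 ≤ q ∧ ENNReal.ofReal q < b then {a | ENNReal.ofReal (y a) ≤ H a q} else ∅ := by
    ext a
    simp only [mem_preimage, mem_Iio, mem_iUnion]
    constructor
    · intro h
      simp only [hittingLevel, iInf_lt_iff] at h
      obtain ⟨t, ht, htb⟩ := h
      obtain ⟨c, -, htc, hcb⟩ := ENNReal.lt_iff_exists_real_btwn.1 htb
      have htc' : (t : ℝ) < c := by
        rw [← ENNReal.ofReal_coe_nnreal] at htc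
        exact (ENNReal.ofReal_lt_ofReal_iff_of_nonneg t.coe_nonneg).1 htc
      obtain ⟨q, hq1, hq2⟩ := exists_rat_btwn htc'
      have hq0 : (0 : ℝ) ≤ q := t.coe_nonneg.trans hq1.le
      refine ⟨q, ?_⟩
      rw [if_pos ⟨by exact_mod_cast hq0, (ENNReal.ofReal_le_ofReal hq2.le).trans_lt hcb⟩]
      exact ht.trans (hmono a hq1.le)
    · rintro ⟨q, hq⟩
      split_ifs at hq with h
      · exact (hittingLevel_le (by exact_mod_cast h.1) hq).trans_lt h.2
      · exact absurd hq (notMem_empty a)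
  rw [this]
  refine MeasurableSet.iUnion fun q => ?_
  split_ifs
  · exact measurableSet_le hy.ennreal_ofReal
      (hH.comp (measurable_id.prodMk measurable_const))
  · exact MeasurableSet.empty

theorem measurable_setLIntegral_Icc {α : Type*} [MeasurableSpace α] {f : α × ℝ → ℝ≥0∞}
    (hf : Measurable f) {t : α → ℝ} (ht : Measurable t) :
    Measurable fun a => ∫⁻ s in Icc 0 (t a), f (a, s) := by
  have hS : MeasurableSet {p : α × ℝ | p.2 ∈ Icc 0 (t p.1)} :=
    (measurableSet_le measurable_const measurable_snd).inter
      (measurableSet_le measurable_snd (ht.comp measurable_fst))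
  have heq : (fun a => ∫⁻ s in Icc 0 (t a), f (a, s)) =
      fun a => ∫⁻ s, {p : α × ℝ | p.2 ∈ Icc 0 (t p.1)}.indicator f (a, s) := by
    ext a
    rw [← lintegral_indicator measurableSet_Icc]
    rfl
  rw [heq]
  exact (hf.indicator hS).lintegral_prod_right'

namespace CapitalModel

theorem measurable_lossTime {α : Type*} [MeasurableSpace α] {T : α → ℕ → ℝ} (hT : Measurable T)
    (n : ℕ) : Measurable fun a => lossTime (T a) n := by
  unfold lossTime
  exact Finset.measurable_fun_sum _ fun i _ => (measurable_pi_apply i).comp hT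

theorem measurable_lossCount {α : Type*} [MeasurableSpace α] {T : α → ℕ → ℝ} (hT : Measurable T)
    {t : α → ℝ} (ht : Measurable t) : Measurable fun a => lossCount (T a) (t a) := by
  refine measurable_ncard.comp (measurable_set_iff.2 fun n => ?_)
  exact measurableSet_setOfPred.1 (measurableSet_le (measurable_lossTime hT _) ht)

theorem measurable_capitalAtLoss (M : CapitalModel) {α : Type*} [MeasurableSpace α]
    {T Z : α → ℕ → ℝ} (hT : Measurable T) (hZ : Measurable Z) {x : α → ℝ} (hx : Measurable x)
    (n : ℕ) : Measurable fun a => M.capitalAtLoss (T a) (Z a) (x a) n := by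
  induction n with
  | zero => exact hx
  | succ n ih =>
    exact ((measurable_pi_apply n).comp hZ).mul
      (M.continuous_uncurry_flow.measurable.comp (ih.prodMk ((measurable_pi_apply n).comp hT)))

/-- For a fixed number of losses the capital is a measurable expression in the noise; the actual
number of losses is a measurable index in a countable set. -/
theorem measurable_capital (M : CapitalModel) {α : Type*} [MeasurableSpace α]
    {T Z : α → ℕ → ℝ} (hT : Measurable T) (hZ : Measurable Z) {x t : α → ℝ} (hx : Measurable x)
    (ht : Measurable t) : Measurable fun a => M.capital (T a) (Z a) (x a) (t a) := by
  have h : Measurable fun q : α × ℕ =>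
      M.flow (M.capitalAtLoss (T q.1) (Z q.1) (x q.1) q.2) (t q.1 - lossTime (T q.1) q.2) :=
    measurable_from_prod_countable_left fun n => M.continuous_uncurry_flow.measurable.comp
      ((M.measurable_capitalAtLoss hT hZ hx n).prodMk (ht.sub (measurable_lossTime hT n)))
  exact h.comp (measurable_id.prodMk (measurable_lossCount hT ht))

theorem measurable_hazard (M : CapitalModel) {rate : ℝ → ℝ≥0} (hrate : Measurable rate)
    {α : Type*} [MeasurableSpace α] {T Z : α → ℕ → ℝ} (hT : Measurable T) (hZ : Measurable Z)
    {x t : α → ℝ} (hx : Measurable x) (ht : Measurable t) :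
    Measurable fun a => M.hazard rate (T a) (Z a) (x a) (t a) := by
  have hc : Measurable fun p : α × ℝ => M.capital (T p.1) (Z p.1) (x p.1) p.2 :=
    M.measurable_capital (hT.comp measurable_fst) (hZ.comp measurable_fst)
      (hx.comp measurable_fst) measurable_snd
  exact measurable_setLIntegral_Icc (f := fun p : α × ℝ =>
    if M.capital (T p.1) (Z p.1) (x p.1) p.2 < M.xStar
      then (rate (M.capital (T p.1) (Z p.1) (x p.1) p.2) : ℝ≥0∞) else 0)
    (Measurable.ite (measurableSet_lt hc measurable_const)
      (hrate.comp hc).coe_nnreal_ennreal measurable_const) ht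

theorem measurable_povertyTime (M : CapitalModel) {rate : ℝ → ℝ≥0} (hrate : Measurable rate)
    {α : Type*} [MeasurableSpace α] {T Z : α → ℕ → ℝ} (hT : Measurable T) (hZ : Measurable Z)
    {x e : α → ℝ} (hx : Measurable x) (he : Measurable e) :
    Measurable fun a => M.povertyTime rate (T a) (Z a) (e a) (x a) :=
  measurable_hittingLevel (H := fun a => M.hazard rate (T a) (Z a) (x a))
    (M.measurable_hazard hrate (hT.comp measurable_fst) (hZ.comp measurable_fst)
      (hx.comp measurable_fst) measurable_snd)
    (fun _ => M.monotone_hazard rate _ _ _) he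

/-- A jointly measurable function which agrees with `discountedPenalty` on regular paths. -/
noncomputable def sequentialPenalty (M : CapitalModel) (rate : ℝ → ℝ≥0) (w : ℝ → ℝ → ℝ≥0) (δ : ℝ)
    (T Z : ℕ → ℝ) (e x : ℝ) : ℝ≥0∞ :=
  if M.povertyTime rate T Z e x = ∞ then 0
  else (w (limsup (fun n : ℕ => M.capital T Z x
        ((M.povertyTime rate T Z e x).toReal - 1 / ((n : ℝ) + 1))) atTop)
      |M.capital T Z x (M.povertyTime rate T Z e x).toReal - M.xStar| : ℝ≥0∞) *
    ENNReal.ofReal (Real.exp (-δ * (M.povertyTime rate T Z e x).toReal))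

/-- Left limits exist on regular paths, so they may be computed along the sequence `t - 1 / (n +
1)`; the resulting `limsup` is visibly measurable in the whole path. -/
theorem discountedPenalty_eq_sequentialPenalty (M : CapitalModel) (rate : ℝ → ℝ≥0)
    (w : ℝ → ℝ → ℝ≥0) (δ : ℝ) {T : ℕ → ℝ} (hT : RegularTimes T) (Z : ℕ → ℝ) (e x : ℝ) :
    M.discountedPenalty rate w δ T Z e x = M.sequentialPenalty rate w δ T Z e x := by
  rw [discountedPenalty, sequentialPenalty]
  set t := (M.povertyTime rate T Z e x).toReal
  obtain ⟨y, hy⟩ := M.exists_tendsto_capital_left hT Z x t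
  have h1 : Tendsto (fun n : ℕ => t - 1 / ((n : ℝ) + 1)) atTop (𝓝[<] t) := by
    refine tendsto_nhdsWithin_iff.2 ⟨?_, Eventually.of_forall fun n => ?_⟩
    · simpa using tendsto_const_nhds.sub (tendsto_one_div_add_atTop_nhds_zero_nat (𝕜 := ℝ))
    · have : 0 < 1 / ((n : ℝ) + 1) := by positivity
      simp only [mem_Iio]; linarith
  simp only [leftLim_eq_of_tendsto hy]
  rw [← (hy.comp h1).limsup_eq]
  rfl

theorem measurable_sequentialPenalty (M : CapitalModel) {rate : ℝ → ℝ≥0} (hrate : Measurable rate)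
    {w : ℝ → ℝ → ℝ≥0} (hw : Measurable (Function.uncurry w)) (δ : ℝ)
    {α : Type*} [MeasurableSpace α] {T Z : α → ℕ → ℝ} (hT : Measurable T) (hZ : Measurable Z)
    {x e : α → ℝ} (hx : Measurable x) (he : Measurable e) :
    Measurable fun a => M.sequentialPenalty rate w δ (T a) (Z a) (e a) (x a) := by
  have hτ := M.measurable_povertyTime hrate hT hZ hx he
  refine Measurable.ite (hτ (measurableSet_singleton ∞)) measurable_const ?_
  refine Measurable.fun_mul ?_ ?_
  · refine (hw.comp (Measurable.prodMk ?_ ?_)).coe_nnreal_ennreal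
    · exact Measurable.limsup fun n => M.measurable_capital hT hZ hx
        (hτ.ennreal_toReal.sub measurable_const)
    · exact continuous_abs.measurable.comp
        ((M.measurable_capital hT hZ hx hτ.ennreal_toReal).sub measurable_const)
  · exact (hτ.ennreal_toReal.const_mul _).exp.ennreal_ofReal

end CapitalModel

/-! ### The law of the noise and its self-similarity after the first loss. -/

/-- Coordinates indexed by disjoint sets are independent under a product measure. This separates the
level from the losses, and the first waiting time and first proportion from the later ones. -/
theorem map_infinitePi_eval_comp {I J : Type*} {X : Type*} [MeasurableSpace X]
    (μ : I → Measure X) [∀ i, IsProbabilityMeasure (μ i)] (i₀ : I) {σ : J → I}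
    (hσ : σ.Injective) (h : i₀ ∉ range σ) :
    (Measure.infinitePi μ).map (fun ω => (ω i₀, fun j => ω (σ j))) =
      (μ i₀).prod (Measure.infinitePi fun j => μ (σ j)) := by
  have hind : iIndepFun (fun i (ω : I → X) => ω i) (Measure.infinitePi μ) :=
    iIndepFun_infinitePi (X := fun _ => id) fun _ => measurable_id
  have h1 : (Measure.infinitePi μ).map (fun ω => ω i₀) = μ i₀ := Measure.infinitePi_map_eval μ i₀
  have h2 : (Measure.infinitePi μ).map (fun ω j => ω (σ j)) =
      Measure.infinitePi fun j => μ (σ j) := by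
    rw [(hind.precomp hσ).map_fun_eq_infinitePi_map fun j => measurable_pi_apply _]
    congr
    ext1 j
    exact Measure.infinitePi_map_eval μ (σ j)
  have hI := indep_iSup_of_disjoint (fun i => (measurable_pi_apply i).comap_le) hind.iIndep
    (S := {i₀}) (T := range σ) (by simpa using h)
  have hIF : IndepFun (fun ω : I → X => ω i₀) (fun ω j => ω (σ j)) (Measure.infinitePi μ) := by
    rw [IndepFun_iff_Indep]
    refine indep_of_indep_of_le_left (indep_of_indep_of_le_right hI ?_) ?_
    · refine measurable_iff_comap_le.1 ?_
      refine @measurable_pi_lambda _ _ _ (_) _ _ fun j => ?_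
      exact measurable_iff_comap_le.2 (le_iSup₂_of_le (σ j) (mem_range_self j) le_rfl)
    · exact le_iSup₂_of_le i₀ rfl le_rfl
  rw [hIF.map_prod_eq_prod_map_map (measurable_pi_apply i₀).aemeasurable
    (measurable_pi_lambda _ fun j => measurable_pi_apply (σ j)).aemeasurable, h1, h2]

theorem lintegral_expMeasure (r : ℝ) {f : ℝ → ℝ≥0∞} (hf : Measurable f) :
    ∫⁻ x, f x ∂(expMeasure r) =
      ∫⁻ x in Ioi 0, ENNReal.ofReal (r * Real.exp (-(r * x))) * f x := by
  have hm : Measurable (gammaPDF 1 r) := (measurable_gammaPDFReal 1 r).ennreal_ofReal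
  have heq : gammaPDF 1 r = exponentialPDF r := rfl
  rw [expMeasure, gammaMeasure, lintegral_withDensity_eq_lintegral_mul _ hm hf,
    setLIntegral_congr Ioi_ae_eq_Ici, ← lintegral_indicator measurableSet_Ici]
  refine lintegral_congr fun x => ?_
  simp only [Pi.mul_apply, heq, exponentialPDF_eq]
  by_cases hx : 0 ≤ x
  · simp [hx]
  · simp [hx]

theorem ae_expMeasure_pos (r : ℝ) : ∀ᵐ x ∂(expMeasure r), 0 < x := by
  rw [ae_iff]
  have hS : MeasurableSet {x : ℝ | ¬ 0 < x} := by
    simpa only [not_lt] using! measurableSet_Iic (a := (0 : ℝ))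
  rw [← lintegral_indicator_one hS, lintegral_expMeasure r (measurable_one.indicator hS)]
  rw [setLIntegral_congr_fun (g := 0) measurableSet_Ioi fun x hx => ?_]
  · simp
  · have : x ∉ {x : ℝ | ¬ 0 < x} := fun h => h hx
    rw [indicator_of_notMem this, mul_zero, Pi.zero_apply]

theorem expMeasure_Ioi_one_ne_zero {r : ℝ} (hr : 0 < r) : expMeasure r (Ioi 1) ≠ 0 := by
  have := isProbabilityMeasure_expMeasure hr
  intro h
  have h1 : cdf (expMeasure r) 1 = 1 := by
    have h2 : expMeasure r (Iic 1) = 1 := by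
      rw [← prob_compl_eq_zero_iff measurableSet_Iic, compl_Iic]; exact h
    rw [cdf_eq_real, measureReal_def, h2, ENNReal.toReal_one]
  rw [cdf_expMeasure_eq hr] at h1
  have := Real.exp_pos (-(r * 1))
  simp at h1

/-- The laws of the waiting times and of the remaining proportions. -/
noncomputable def lossLaw (lam : ℝ) (G : Measure ℝ) : ℕ ⊕ ℕ → Measure ℝ :=
  Sum.elim (fun _ => expMeasure lam) (fun _ => G)

theorem isProbabilityMeasure_lossLaw {lam : ℝ} (hlam : 0 < lam) (G : Measure ℝ)
    [IsProbabilityMeasure G] (i : ℕ ⊕ ℕ) : IsProbabilityMeasure (lossLaw lam G i) := by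
  rcases i with i | i
  · exact isProbabilityMeasure_expMeasure hlam
  · simpa [lossLaw]

/-- The joint law of the waiting times and of the remaining proportions. -/
noncomputable def noiseLaw (lam : ℝ) (G : Measure ℝ) : Measure (ℕ ⊕ ℕ → ℝ) :=
  Measure.infinitePi (lossLaw lam G)

theorem isProbabilityMeasure_noiseLaw {lam : ℝ} (hlam : 0 < lam) (G : Measure ℝ)
    [IsProbabilityMeasure G] : IsProbabilityMeasure (noiseLaw lam G) := by
  have := isProbabilityMeasure_lossLaw hlam G
  unfold noiseLaw
  infer_instance

/-- By the second Borel–Cantelli lemma infinitely many waiting times exceed `1`, because these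
independent events share one positive probability; hence the loss times diverge. -/
theorem ae_regularTimes {lam : ℝ} (hlam : 0 < lam) (G : Measure ℝ) [IsProbabilityMeasure G] :
    ∀ᵐ R ∂(noiseLaw lam G), RegularTimes fun n => R (Sum.inl n) := by
  have := isProbabilityMeasure_lossLaw hlam G
  have := isProbabilityMeasure_noiseLaw hlam G
  have hmap (n : ℕ) : (noiseLaw lam G).map (fun R => R (Sum.inl n)) = expMeasure lam :=
    Measure.infinitePi_map_eval (lossLaw lam G) (Sum.inl n)
  have hpos : ∀ᵐ R ∂(noiseLaw lam G), ∀ n, 0 < R (Sum.inl n) := by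
    refine ae_all_iff.2 fun n => ?_
    refine ae_of_ae_map (f := fun R : ℕ ⊕ ℕ → ℝ => R (Sum.inl n))
      (measurable_pi_apply _).aemeasurable (p := fun x => 0 < x) ?_
    rw [hmap]; exact ae_expMeasure_pos lam
  have hind : iIndepFun (fun n (R : ℕ ⊕ ℕ → ℝ) => R (Sum.inl n)) (noiseLaw lam G) :=
    iIndepFun.precomp Sum.inl_injective
      (iIndepFun_infinitePi (P := lossLaw lam G) (X := fun _ => id) fun _ => measurable_id)
  let s : ℕ → Set (ℕ ⊕ ℕ → ℝ) := fun n => (fun R => R (Sum.inl n)) ⁻¹' Ioi 1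
  have hsm (n : ℕ) : MeasurableSet (s n) := measurable_pi_apply _ measurableSet_Ioi
  have hs : iIndepSet s (noiseLaw lam G) := by
    rw [iIndepSet_iff_meas_biInter hsm]
    exact fun S => hind.meas_biInter fun i _ => ⟨Ioi 1, measurableSet_Ioi, rfl⟩
  have hsum : ∑' n, noiseLaw lam G (s n) = ∞ := by
    have (n : ℕ) : noiseLaw lam G (s n) = expMeasure lam (Ioi 1) := by
      rw [← hmap n, Measure.map_apply (measurable_pi_apply _) measurableSet_Ioi]
    simp_rw [this]
    exact ENNReal.tsum_const_eq_top_of_ne_zero (expMeasure_Ioi_one_ne_zero hlam)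
  have hlim : ∀ᵐ R ∂(noiseLaw lam G), R ∈ limsup s atTop :=
    (mem_ae_iff_prob_eq_one (MeasurableSet.measurableSet_limsup hsm)).2
      (measure_limsup_eq_one hsm hs hsum)
  filter_upwards [hpos, hlim] with R h1 h2
  refine ⟨h1, ?_⟩
  have hmono : Monotone (CapitalModel.lossTime fun n => R (Sum.inl n)) :=
    monotone_nat_of_le_succ fun n => by
      rw [CapitalModel.lossTime_succ]; linarith [h1 n]
  rw [mem_limsup_iff_frequently_mem] at h2
  have key (k : ℕ) : ∃ n, (k : ℝ) ≤ CapitalModel.lossTime (fun n => R (Sum.inl n)) n := by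
    induction k with
    | zero => exact ⟨0, by simp [CapitalModel.lossTime_zero]⟩
    | succ k ih =>
      obtain ⟨n, hn⟩ := ih
      obtain ⟨m, hm, hRm⟩ := frequently_atTop.1 h2 n
      refine ⟨m + 1, ?_⟩
      rw [CapitalModel.lossTime_succ]
      have : 1 < R (Sum.inl m) := hRm
      push_cast
      linarith [hmono hm]
  refine tendsto_atTop_atTop_of_monotone hmono fun b => ?_
  obtain ⟨k, hk⟩ := exists_nat_ge b
  obtain ⟨n, hn⟩ := key k
  exact ⟨n, hk.trans hn⟩

/-- Forget the first waiting time. -/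
def shiftTimes : ℕ ⊕ ℕ → ℕ ⊕ ℕ := Sum.map (· + 1) id

/-- Forget the first remaining proportion. -/
def shiftProportions : ℕ ⊕ ℕ → ℕ ⊕ ℕ := Sum.map id (· + 1)

/-- The noise splits into the first waiting time, the first proportion and a remainder with the law
of the full noise. The two first coordinates are peeled off one after the other, and the two shifts
compose to the joint shift. -/
theorem lintegral_noiseLaw {lam : ℝ} (hlam : 0 < lam) (G : Measure ℝ) [IsProbabilityMeasure G]
    {f : ℝ → ℝ → (ℕ ⊕ ℕ → ℝ) → ℝ≥0∞}
    (hf : Measurable fun p : ℝ × ℝ × (ℕ ⊕ ℕ → ℝ) => f p.1 p.2.1 p.2.2) :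
    ∫⁻ R, f (R (Sum.inl 0)) (R (Sum.inr 0)) (fun j => R (Sum.map (· + 1) (· + 1) j))
        ∂(noiseLaw lam G) =
      ∫⁻ t, ∫⁻ z, ∫⁻ R, f t z R ∂(noiseLaw lam G) ∂G ∂(expMeasure lam) := by
  have := isProbabilityMeasure_lossLaw hlam G
  have := isProbabilityMeasure_noiseLaw hlam G
  have := isProbabilityMeasure_expMeasure hlam
  have h1 : (noiseLaw lam G).map (fun R => (R (Sum.inl 0), fun j => R (shiftTimes j))) =
      (expMeasure lam).prod (noiseLaw lam G) := by
    rw [noiseLaw, map_infinitePi_eval_comp (lossLaw lam G) (Sum.inl 0) (σ := shiftTimes)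
      (Sum.map_injective.2 ⟨add_left_injective 1, Function.injective_id⟩)
      (by simp [shiftTimes])]
    congr 2
    ext1 j
    rcases j with j | j <;> rfl
  have h2 : (noiseLaw lam G).map (fun R => (R (Sum.inr 0), fun j => R (shiftProportions j))) =
      G.prod (noiseLaw lam G) := by
    rw [noiseLaw, map_infinitePi_eval_comp (lossLaw lam G) (Sum.inr 0) (σ := shiftProportions)
      (Sum.map_injective.2 ⟨Function.injective_id, add_left_injective 1⟩)
      (by simp [shiftProportions])]
    congr 2
    ext1 j
    rcases j with j | j <;> rfl
  have hshift (R : ℕ ⊕ ℕ → ℝ) : (fun j => R (Sum.map (· + 1) (· + 1) j)) =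
      fun j => (fun i => R (shiftTimes i)) (shiftProportions j) := by
    ext j; rcases j with j | j <;> rfl
  calc _ = ∫⁻ p, f p.1 (p.2 (Sum.inr 0)) (fun j => p.2 (shiftProportions j))
        ∂((noiseLaw lam G).map fun R => (R (Sum.inl 0), fun j => R (shiftTimes j))) := by
        rw [lintegral_map (by fun_prop) (by fun_prop)]
        refine lintegral_congr fun R => ?_
        rw [hshift]; rfl
    _ = ∫⁻ t, ∫⁻ R, f t (R (Sum.inr 0)) (fun j => R (shiftProportions j)) ∂(noiseLaw lam G)
          ∂(expMeasure lam) := by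
        rw [h1, lintegral_prod _ (Measurable.aemeasurable (by fun_prop))]
    _ = _ := by
        refine lintegral_congr fun t => ?_
        have hft : Measurable fun q : ℝ × (ℕ ⊕ ℕ → ℝ) => f t q.1 q.2 :=
          hf.comp (measurable_const.prodMk measurable_id)
        rw [← lintegral_prod _ hft.aemeasurable, ← h2, lintegral_map hft (by fun_prop)]

theorem map_capitalNoise {Ω : Type*} [MeasurableSpace Ω] {P : Measure Ω} [IsProbabilityMeasure P]
    {lam : ℝ} (hlam : 0 < lam) {G : Measure ℝ} [IsProbabilityMeasure G]
    {T Z : ℕ → Ω → ℝ} {E : Ω → ℝ} (h : IsCapitalNoise P lam G T Z E) :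
    HasLaw (fun o => (E o, fun j => Sum.elim T Z j o)) ((expMeasure 1).prod (noiseLaw lam G)) P := by
  have := isProbabilityMeasure_lossLaw hlam G
  have := isProbabilityMeasure_expMeasure one_pos
  let μ : (ℕ ⊕ ℕ) ⊕ Unit → Measure ℝ := Sum.elim (lossLaw lam G) fun _ => expMeasure 1
  have hμ (i) : IsProbabilityMeasure (μ i) := by
    rcases i with i | i
    · simp only [μ, Sum.elim_inl]; infer_instance
    · simp only [μ, Sum.elim_inr]; infer_instance
  have hlaw (i) : HasLaw (Sum.elim (Sum.elim T Z) (fun _ => E) i) (μ i) P := by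
    rcases i with (i | i) | i
    · exact h.law_T i
    · exact h.law_Z i
    · exact h.law_E
  have hX := h.indep.hasLaw_infinitePi hlaw (aemeasurable_pi_iff.2 fun i => (hlaw i).aemeasurable)
  have hmap := map_infinitePi_eval_comp μ (Sum.inr ()) (σ := Sum.inl) Sum.inl_injective (by simp)
  have hpair : HasLaw (fun ω : (ℕ ⊕ ℕ) ⊕ Unit → ℝ => (ω (Sum.inr ()), fun j => ω (Sum.inl j)))
      ((expMeasure 1).prod (noiseLaw lam G)) (Measure.infinitePi μ) :=
    ⟨by fun_prop, hmap⟩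
  exact hpair.comp hX

theorem lintegral_Ioi_exp {lam : ℝ} (hlam : 0 < lam) (a : ℝ) :
    ∫⁻ t in Ioi a, ENNReal.ofReal (lam * Real.exp (-(lam * t))) =
      ENNReal.ofReal (Real.exp (-(lam * a))) := by
  have h0 : Tendsto (fun t : ℝ => -Real.exp (-(lam * t))) atTop (𝓝 0) := by
    have h1 : Tendsto (fun t : ℝ => -(lam * t)) atTop atBot :=
      tendsto_neg_atTop_atBot.comp (tendsto_id.const_mul_atTop hlam)
    simpa using (Real.tendsto_exp_atBot.comp h1).neg
  have hc : ContinuousWithinAt (fun t : ℝ => -Real.exp (-(lam * t))) (Ici a) a := by fun_prop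
  have hd : ∀ t ∈ Ioi a, HasDerivAt (fun t : ℝ => -Real.exp (-(lam * t)))
      (lam * Real.exp (-(lam * t))) t := fun t _ => hasDerivAt_neg_exp_mul_exp
  have hnn : ∀ t ∈ Ioi a, 0 ≤ lam * Real.exp (-(lam * t)) := fun t _ => by positivity
  have hint := integrableOn_Ioi_deriv_of_nonneg hc hd hnn h0
  rw [← ofReal_integral_eq_lintegral_ofReal hint (Eventually.of_forall fun t => by positivity),
    integral_Ioi_of_hasDerivAt_of_tendsto hc hd hint h0]
  simp

theorem ae_expMeasure_ne (r a : ℝ) : ∀ᵐ x ∂(expMeasure r), x ≠ a := by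
  have h : expMeasure r ≪ volume := withDensity_absolutelyContinuous _ _
  exact h.ae_le (compl_mem_ae_iff.2 Real.volume_singleton)

/-- The exponential law has no memory. -/
theorem lintegral_expMeasure_one_sub {ψ : ℝ → ℝ≥0∞} (hψ : Measurable ψ) {H : ℝ≥0∞} (hH : H ≠ ∞) :
    ∫⁻ e, (if H < ENNReal.ofReal e then ψ (e - H.toReal) else 0) ∂(expMeasure 1) =
      ENNReal.ofReal (Real.exp (-H.toReal)) * ∫⁻ e, ψ e ∂(expMeasure 1) := by
  have hm : Measurable fun e : ℝ => if H < ENNReal.ofReal e then ψ (e - H.toReal) else 0 :=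
    Measurable.ite (measurableSet_lt measurable_const (by fun_prop)) (by fun_prop) measurable_const
  have h0 : 0 ≤ H.toReal := ENNReal.toReal_nonneg
  rw [lintegral_expMeasure 1 hm, lintegral_expMeasure 1 hψ,
    ← lintegral_const_mul' _ _ ENNReal.ofReal_ne_top, ← lintegral_indicator measurableSet_Ioi,
    ← lintegral_indicator measurableSet_Ioi, ← lintegral_sub_right_eq_self (fun e => (Ioi (0 : ℝ)).indicator (fun e =>
      ENNReal.ofReal (Real.exp (-H.toReal)) *
        (ENNReal.ofReal (1 * Real.exp (-(1 * e))) * ψ e)) e) H.toReal]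
  refine lintegral_congr fun e => ?_
  have hiff : H < ENNReal.ofReal e ↔ H.toReal < e := by
    rw [← ENNReal.lt_ofReal_iff_toReal_lt hH]
  by_cases he : H.toReal < e
  · have h1 : e ∈ Ioi (0 : ℝ) := h0.trans_lt he
    have h2 : e - H.toReal ∈ Ioi (0 : ℝ) := sub_pos.2 he
    rw [indicator_of_mem h1, indicator_of_mem h2, if_pos (hiff.2 he),
      ← mul_assoc (ENNReal.ofReal _), ← ENNReal.ofReal_mul (Real.exp_pos _).le]
    congr 2
    rw [one_mul, one_mul, one_mul, ← Real.exp_add]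
    congr 1; ring
  · have h2 : e - H.toReal ∉ Ioi (0 : ℝ) := fun h => he (sub_pos.1 h)
    rw [indicator_of_notMem h2]
    rw [indicator_apply_eq_zero]
    exact fun _ => by rw [if_neg (hiff.not.2 he), mul_zero]

/-! ### The renewal equation. -/

namespace CapitalModel

/-- The penalty as a function of the noise `R` (waiting times and remaining proportions). -/
noncomputable def noisePenalty (M : CapitalModel) (rate : ℝ → ℝ≥0) (w : ℝ → ℝ → ℝ≥0) (δ : ℝ)
    (R : ℕ ⊕ ℕ → ℝ) (e x : ℝ) : ℝ≥0∞ :=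
  M.sequentialPenalty rate w δ (fun n => R (Sum.inl n)) (fun n => R (Sum.inr n)) e x

theorem measurable_noisePenalty (M : CapitalModel) {rate : ℝ → ℝ≥0} (hrate : Measurable rate)
    {w : ℝ → ℝ → ℝ≥0} (hw : Measurable (Function.uncurry w)) (δ : ℝ)
    {α : Type*} [MeasurableSpace α] {R : α → ℕ ⊕ ℕ → ℝ} (hR : Measurable R)
    {x e : α → ℝ} (hx : Measurable x) (he : Measurable e) :
    Measurable fun a => M.noisePenalty rate w δ (R a) (e a) (x a) :=
  M.measurable_sequentialPenalty hrate hw δ (by fun_prop) (by fun_prop) hx he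

/-- The expected penalty given the level `e` at which the hazard triggers extreme poverty. -/
noncomputable def levelPenalty (M : CapitalModel) (lam : ℝ) (G : Measure ℝ) (rate : ℝ → ℝ≥0)
    (w : ℝ → ℝ → ℝ≥0) (δ : ℝ) (e x : ℝ) : ℝ≥0∞ :=
  ∫⁻ R, M.noisePenalty rate w δ R e x ∂(noiseLaw lam G)

theorem measurable_levelPenalty (M : CapitalModel) {lam : ℝ} (hlam : 0 < lam) (G : Measure ℝ)
    [IsProbabilityMeasure G] {rate : ℝ → ℝ≥0} (hrate : Measurable rate)
    {w : ℝ → ℝ → ℝ≥0} (hw : Measurable (Function.uncurry w)) (δ : ℝ)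
    {α : Type*} [MeasurableSpace α] {x e : α → ℝ} (hx : Measurable x) (he : Measurable e) :
    Measurable fun a => M.levelPenalty lam G rate w δ (e a) (x a) := by
  have := isProbabilityMeasure_noiseLaw hlam G
  exact (M.measurable_noisePenalty hrate hw δ (R := fun p : α × (ℕ ⊕ ℕ → ℝ) => p.2) measurable_snd
    (hx.comp measurable_fst) (he.comp measurable_fst)).lintegral_prod_right'

/-- The expectation depends only on the joint law of the noise, so it moves to the canonical product
space, where the penalty is almost surely its measurable version. -/
theorem expectedPenalty_eq (M : CapitalModel) {Ω : Type*} [MeasurableSpace Ω]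
    {P : Measure Ω} [IsProbabilityMeasure P] {lam : ℝ} (hlam : 0 < lam)
    {G : Measure ℝ} [IsProbabilityMeasure G] {T Z : ℕ → Ω → ℝ} {E : Ω → ℝ}
    (h : IsCapitalNoise P lam G T Z E) {rate : ℝ → ℝ≥0} (hrate : Measurable rate)
    {w : ℝ → ℝ → ℝ≥0} (hw : Measurable (Function.uncurry w)) (δ x : ℝ) :
    M.expectedPenalty P T Z E rate w δ x =
      ∫⁻ e, M.levelPenalty lam G rate w δ e x ∂(expMeasure 1) := by
  have := isProbabilityMeasure_noiseLaw hlam G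
  have := isProbabilityMeasure_expMeasure one_pos
  have hlaw := map_capitalNoise hlam h
  have hΦ : Measurable fun p : ℝ × (ℕ ⊕ ℕ → ℝ) => M.noisePenalty rate w δ p.2 p.1 x :=
    M.measurable_noisePenalty hrate hw δ measurable_snd measurable_const measurable_fst
  have hreg : ∀ᵐ o ∂P, RegularTimes fun n => T n o := by
    refine ae_of_ae_map (p := fun q : ℝ × (ℕ ⊕ ℕ → ℝ) => RegularTimes fun n => q.2 (Sum.inl n))
      hlaw.aemeasurable ?_
    rw [hlaw.map_eq]
    exact Measure.quasiMeasurePreserving_snd.ae (ae_regularTimes hlam G)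
  calc _ = ∫⁻ o, M.noisePenalty rate w δ (fun j => Sum.elim T Z j o) (E o) x ∂P := by
        refine lintegral_congr_ae ?_
        filter_upwards [hreg] with o ho
        exact M.discountedPenalty_eq_sequentialPenalty rate w δ ho _ _ _
    _ = ∫⁻ p : ℝ × (ℕ ⊕ ℕ → ℝ), M.noisePenalty rate w δ p.2 p.1 x
          ∂(expMeasure 1).prod (noiseLaw lam G) := by
        rw [← hlaw.map_eq, lintegral_map' hΦ.aemeasurable hlaw.aemeasurable]
    _ = _ := lintegral_prod _ hΦ.aemeasurable

/-- The discounted penalty if extreme poverty occurs at time `t`, before the first loss. -/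
noncomputable def flowPenalty (M : CapitalModel) (w : ℝ → ℝ → ℝ≥0) (δ x t : ℝ) : ℝ≥0∞ :=
  w (M.flow x t) |M.flow x t - M.xStar| * ENNReal.ofReal (Real.exp (-δ * t))

theorem measurable_flowPenalty (M : CapitalModel) {w : ℝ → ℝ → ℝ≥0}
    (hw : Measurable (Function.uncurry w)) (δ x : ℝ) : Measurable (M.flowPenalty w δ x) := by
  have hc := (M.continuous_flow x).measurable
  refine Measurable.fun_mul (hw.comp (hc.prodMk ?_)).coe_nnreal_ennreal (by fun_prop)
  exact continuous_abs.measurable.comp (hc.sub measurable_const)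

/-- Conditioning on the first loss with the level `e` held fixed, since the restarted path sees the
lowered level. Survival up to the loss is expressed as hazard below `e`, the form required by
`lintegral_expMeasure_one_sub`. -/
theorem levelPenalty_eq (M : CapitalModel) {lam : ℝ} (hlam : 0 < lam) {G : Measure ℝ}
    [IsProbabilityMeasure G] (hG : ∀ᵐ z ∂G, z ∈ Icc (0 : ℝ) 1)
    {rate : ℝ → ℝ≥0} (hrate : Measurable rate)
    (hrate_int : ∀ a ∈ Ioo 0 M.xStar, IntegrableOn (fun u => (rate u : ℝ)) (Ico a M.xStar))
    (hrate_zero : G {0} ≠ 0 → IntegrableOn (fun u => (rate u : ℝ)) (Ico 0 M.xStar))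
    {w : ℝ → ℝ → ℝ≥0} (hw : Measurable (Function.uncurry w)) (δ : ℝ) {x : ℝ} (hx : 0 < x)
    (e : ℝ) :
    M.levelPenalty lam G rate w δ e x =
      ∫⁻ t, (if hittingLevel (M.flowHazard rate x) e < ENNReal.ofReal t then
          M.flowPenalty w δ x (hittingLevel (M.flowHazard rate x) e).toReal else 0) +
        ∫⁻ z, (if M.flowHazard rate x t < ENNReal.ofReal e then
          ENNReal.ofReal (Real.exp (-δ * t)) * M.levelPenalty lam G rate w δ
            (e - (M.flowHazard rate x t).toReal) (z * M.flow x t) else 0) ∂G ∂(expMeasure lam) := by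
  have := isProbabilityMeasure_lossLaw hlam G
  have := isProbabilityMeasure_noiseLaw hlam G
  set τ := hittingLevel (M.flowHazard rate x) e with hτ
  let Φ : ℝ → ℝ → (ℕ ⊕ ℕ → ℝ) → ℝ≥0∞ := fun t z R =>
    (if τ < ENNReal.ofReal t then M.flowPenalty w δ x τ.toReal else 0) +
      (if M.flowHazard rate x t < ENNReal.ofReal e then
        ENNReal.ofReal (Real.exp (-δ * t)) * M.noisePenalty rate w δ R
          (e - (M.flowHazard rate x t).toReal) (z * M.flow x t) else 0)
  have hH : Measurable (M.flowHazard rate x) := (M.monotone_flowHazard rate x).measurable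
  have hφ : Measurable (M.flow x) := (M.continuous_flow x).measurable
  have hN : Measurable fun p : ℝ × ℝ × (ℕ ⊕ ℕ → ℝ) => M.noisePenalty rate w δ p.2.2
      (e - (M.flowHazard rate x p.1).toReal) (p.2.1 * M.flow x p.1) :=
    M.measurable_noisePenalty hrate hw δ (by fun_prop) (by fun_prop) (by fun_prop)
  have hΦ : Measurable fun p : ℝ × ℝ × (ℕ ⊕ ℕ → ℝ) => Φ p.1 p.2.1 p.2.2 := by
    refine Measurable.fun_add ?_ ?_
    · exact Measurable.ite (measurableSet_lt measurable_const (by fun_prop)) measurable_const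
        measurable_const
    · exact Measurable.ite (measurableSet_lt (by fun_prop) measurable_const)
        (Measurable.fun_mul (by fun_prop) hN) measurable_const
  -- The waiting time has no atoms, so a tie between first loss and hitting time is negligible.
  have hT0 : ∀ᵐ R ∂(noiseLaw lam G), R (Sum.inl 0) ≠ τ.toReal := by
    refine ae_of_ae_map (f := fun R : ℕ ⊕ ℕ → ℝ => R (Sum.inl 0))
      (measurable_pi_apply _).aemeasurable (p := fun t => t ≠ τ.toReal) ?_
    rw [noiseLaw, Measure.infinitePi_map_eval (lossLaw lam G) (Sum.inl 0)]
    exact ae_expMeasure_ne lam _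
  -- A restart from capital `0` matters only when `G` has an atom at `0`, which is exactly when
  -- integrability of the rate down to `0` is available.
  have hZ0 : ∀ᵐ R ∂(noiseLaw lam G), 0 ≤ R (Sum.inr 0) ∧ (R (Sum.inr 0) = 0 → G {0} ≠ 0) := by
    refine ae_of_ae_map (f := fun R : ℕ ⊕ ℕ → ℝ => R (Sum.inr 0))
      (measurable_pi_apply _).aemeasurable (p := fun z => 0 ≤ z ∧ (z = 0 → G {0} ≠ 0)) ?_
    rw [noiseLaw, Measure.infinitePi_map_eval (lossLaw lam G) (Sum.inr 0)]
    have h0 : ∀ᵐ z ∂G, z = 0 → G {0} ≠ 0 := by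
      by_cases h : G {0} = 0
      · filter_upwards [compl_mem_ae_iff.2 h] with z hz hz0
        exact absurd hz0 hz
      · exact Eventually.of_forall fun _ _ => h
    change ∀ᵐ z ∂G, _
    filter_upwards [hG, h0] with z h1 h2 using ⟨h1.1, h2⟩
  calc _ = ∫⁻ R, Φ (R (Sum.inl 0)) (R (Sum.inr 0)) (fun j => R (Sum.map (· + 1) (· + 1) j))
        ∂(noiseLaw lam G) := by
        refine lintegral_congr_ae ?_
        filter_upwards [ae_regularTimes hlam G, hT0, hZ0] with R hreg ht hz
        have ht0 : 0 < R (Sum.inl 0) := hreg.1 0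
        rw [noisePenalty, ← M.discountedPenalty_eq_sequentialPenalty rate w δ hreg]
        have hx' : 0 < M.flow x (R (Sum.inl 0)) := hx.trans_le (M.le_flow x ht0.le)
        have hfin : ∀ t, M.flowHazard rate (R (Sum.inr 0) * M.flow x (R (Sum.inl 0))) t ≠ ∞ := by
          refine fun t => (M.flowHazard_lt_top ?_ t).ne
          rcases hz.1.eq_or_lt with h | h
          · rw [← h, zero_mul]; exact hrate_zero (hz.2 h.symm)
          · have hpos := mul_pos h hx'
            rcases lt_or_ge (R (Sum.inr 0) * M.flow x (R (Sum.inl 0))) M.xStar with h1 | h1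
            · exact hrate_int _ ⟨hpos, h1⟩
            · rw [Ico_eq_empty (not_lt.2 h1)]; exact integrableOn_empty
        rcases lt_trichotomy τ (ENNReal.ofReal (R (Sum.inl 0))) with hlt | heq | hgt
        · have hnot : ¬ M.flowHazard rate x (R (Sum.inl 0)) < ENNReal.ofReal e := by
            obtain ⟨s, -, hs, hes⟩ := exists_of_hittingLevel_lt hlt
            exact not_lt.2 (hes.trans (M.monotone_flowHazard rate x hs.le))
          simp only [Φ, hlt, hnot, if_true, if_false, add_zero]
          exact M.discountedPenalty_of_lt rate w δ hreg _ hlt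
        · exact absurd (by rw [heq, ENNReal.toReal_ofReal ht0.le]) ht
        · have hH' := M.flowHazard_lt_of_lt_hittingLevel ht0.le hgt
          simp only [Φ, hgt.not_gt, hH', if_true, if_false, zero_add]
          rw [M.discountedPenalty_of_gt hrate w δ hreg _ hgt hfin, 
            M.discountedPenalty_eq_sequentialPenalty rate w δ hreg.shift]
          rfl
    _ = _ := by
        rw [lintegral_noiseLaw hlam G hΦ]
        refine lintegral_congr fun t => ?_
        have hNt (z : ℝ) : Measurable fun R : ℕ ⊕ ℕ → ℝ => M.noisePenalty rate w δ R
            (e - (M.flowHazard rate x t).toReal) (z * M.flow x t) :=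
          M.measurable_noisePenalty hrate hw δ measurable_id measurable_const measurable_const
        have hcong (z : ℝ) : ∫⁻ R, Φ t z R ∂(noiseLaw lam G) =
            (if τ < ENNReal.ofReal t then M.flowPenalty w δ x τ.toReal else 0) +
              (if M.flowHazard rate x t < ENNReal.ofReal e then
                ENNReal.ofReal (Real.exp (-δ * t)) * M.levelPenalty lam G rate w δ
                  (e - (M.flowHazard rate x t).toReal) (z * M.flow x t) else 0) := by
          simp only [Φ]
          rw [lintegral_add_left measurable_const, lintegral_const, measure_univ, mul_one]
          congr 1
          split_ifs
          · rw [lintegral_const_mul _ (hNt z)]; rfl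
          · simp
        rw [lintegral_congr hcong, lintegral_add_left measurable_const, lintegral_const,
          measure_univ, mul_one]

/-- The rate of extreme poverty `ω(u) 1_{u < x*}` at the capital `u`. -/
noncomputable def killingRate (M : CapitalModel) (rate : ℝ → ℝ≥0) (u : ℝ) : ℝ≥0∞ :=
  if u < M.xStar then (rate u : ℝ≥0∞) else 0

theorem measurable_killingRate (M : CapitalModel) {rate : ℝ → ℝ≥0} (hrate : Measurable rate) :
    Measurable (M.killingRate rate) :=
  Measurable.ite measurableSet_Iio hrate.coe_nnreal_ennreal measurable_const

/-- The expected discounted penalty, expressed through the canonical law of the noise. -/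
noncomputable def meanPenalty (M : CapitalModel) (lam : ℝ) (G : Measure ℝ) (rate : ℝ → ℝ≥0)
    (w : ℝ → ℝ → ℝ≥0) (δ x : ℝ) : ℝ≥0∞ :=
  ∫⁻ e, M.levelPenalty lam G rate w δ e x ∂(expMeasure 1)

theorem measurable_meanPenalty (M : CapitalModel) {lam : ℝ} (hlam : 0 < lam) (G : Measure ℝ)
    [IsProbabilityMeasure G] {rate : ℝ → ℝ≥0} (hrate : Measurable rate)
    {w : ℝ → ℝ → ℝ≥0} (hw : Measurable (Function.uncurry w)) (δ : ℝ) :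
    Measurable (M.meanPenalty lam G rate w δ) := by
  have := isProbabilityMeasure_expMeasure one_pos
  exact (M.measurable_levelPenalty hlam G hrate hw δ (x := fun p : ℝ × ℝ => p.1) measurable_fst
    measurable_snd).lintegral_prod_right'

/-- The contribution of extreme poverty before the first loss. -/
theorem lintegral_penalty_before_loss (M : CapitalModel) {lam : ℝ} (hlam : 0 < lam)
    {rate : ℝ → ℝ≥0} (hrate : Measurable rate)
    {w : ℝ → ℝ → ℝ≥0} (hw : Measurable (Function.uncurry w)) (δ : ℝ) {x : ℝ}
    (hfin : ∀ t, M.flowHazard rate x t ≠ ∞) :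
    ∫⁻ e, ∫⁻ t, (if hittingLevel (M.flowHazard rate x) e < ENNReal.ofReal t then
        M.flowPenalty w δ x (hittingLevel (M.flowHazard rate x) e).toReal else 0)
          ∂(expMeasure lam) ∂(expMeasure 1) =
      ∫⁻ t in Ioi 0, ENNReal.ofReal (Real.exp (-(M.flowHazard rate x t).toReal)) *
        (M.killingRate rate (M.flow x t) *
          (M.flowPenalty w δ x t * ENNReal.ofReal (Real.exp (-(lam * t))))) := by
  have := isProbabilityMeasure_expMeasure hlam
  have hτm : Measurable (hittingLevel (M.flowHazard rate x)) :=
    (monotone_hittingLevel _).measurable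
  have hF := M.measurable_flowPenalty hw δ x
  have hm : Measurable fun p : ℝ × ℝ =>
      if hittingLevel (M.flowHazard rate x) p.1 < ENNReal.ofReal p.2 then
        M.flowPenalty w δ x (hittingLevel (M.flowHazard rate x) p.1).toReal else 0 :=
    Measurable.ite (measurableSet_lt (by fun_prop) (by fun_prop)) (by fun_prop) measurable_const
  rw [lintegral_expMeasure 1 hm.lintegral_prod_right']
  refine Eq.trans ?_ (lintegral_exp_hittingLevel (g := fun t => M.killingRate rate (M.flow x t))
    ((M.measurable_killingRate hrate).comp (M.continuous_flow x).measurable) hfin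
    (F := fun t => M.flowPenalty w δ x t * ENNReal.ofReal (Real.exp (-(lam * t))))
    (hF.mul (by fun_prop)))
  refine lintegral_congr fun e => ?_
  change _ = _ * (if hittingLevel (M.flowHazard rate x) e = ∞ then 0 else
    M.flowPenalty w δ x (hittingLevel (M.flowHazard rate x) e).toReal *
      ENNReal.ofReal (Real.exp (-(lam * (hittingLevel (M.flowHazard rate x) e).toReal))))
  rw [one_mul, one_mul]
  congr 1
  change ∫⁻ t, (if hittingLevel (M.flowHazard rate x) e < ENNReal.ofReal t then
    M.flowPenalty w δ x (hittingLevel (M.flowHazard rate x) e).toReal else 0) ∂(expMeasure lam) = _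
  -- With the hitting time `τ` fixed, integrating out the waiting time leaves the probability `exp
  -- (-λ τ)` that no loss precedes it.
  generalize hittingLevel (M.flowHazard rate x) e = τ
  by_cases hinf : τ = ∞
  · simp [hinf]
  · have hlt (t : ℝ) : τ < ENNReal.ofReal t ↔ τ.toReal < t := by
      rw [ENNReal.lt_ofReal_iff_toReal_lt hinf]
    have h0 : 0 ≤ τ.toReal := ENNReal.toReal_nonneg
    have hm1 : Measurable fun t : ℝ =>
        if τ < ENNReal.ofReal t then M.flowPenalty w δ x τ.toReal else 0 :=
      Measurable.ite (measurableSet_lt measurable_const (by fun_prop)) measurable_const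
        measurable_const
    rw [lintegral_expMeasure lam hm1, if_neg hinf, ← lintegral_Ioi_exp hlam,
      ← lintegral_const_mul _ (by fun_prop), ← lintegral_indicator measurableSet_Ioi,
      ← lintegral_indicator measurableSet_Ioi]
    refine lintegral_congr fun t => ?_
    by_cases ht : τ.toReal < t
    · rw [indicator_of_mem (show t ∈ Ioi 0 from h0.trans_lt ht), indicator_of_mem (show t ∈ Ioi _
        from ht), if_pos ((hlt t).2 ht), mul_comm]
    · rw [indicator_of_notMem (show t ∉ Ioi _ from ht), indicator_apply_eq_zero]
      exact fun _ => by rw [if_neg ((hlt t).not.2 ht), mul_zero]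

/-- The contribution of extreme poverty after the first loss. -/
theorem lintegral_penalty_after_loss (M : CapitalModel) {lam : ℝ} (hlam : 0 < lam) {G : Measure ℝ}
    [IsProbabilityMeasure G] {rate : ℝ → ℝ≥0} (hrate : Measurable rate)
    {w : ℝ → ℝ → ℝ≥0} (hw : Measurable (Function.uncurry w)) (δ : ℝ) {x : ℝ}
    (hfin : ∀ t, M.flowHazard rate x t ≠ ∞) :
    ∫⁻ e, ∫⁻ t, ∫⁻ z, (if M.flowHazard rate x t < ENNReal.ofReal e then
        ENNReal.ofReal (Real.exp (-δ * t)) * M.levelPenalty lam G rate w δ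
          (e - (M.flowHazard rate x t).toReal) (z * M.flow x t) else 0)
            ∂G ∂(expMeasure lam) ∂(expMeasure 1) =
      ∫⁻ t in Ioi 0, ENNReal.ofReal (lam * Real.exp (-(lam * t))) *
        (ENNReal.ofReal (Real.exp (-δ * t)) *
          (ENNReal.ofReal (Real.exp (-(M.flowHazard rate x t).toReal)) *
            ∫⁻ z, M.meanPenalty lam G rate w δ (z * M.flow x t) ∂G)) := by
  have := isProbabilityMeasure_expMeasure hlam
  have := isProbabilityMeasure_expMeasure one_pos
  have hH : Measurable (M.flowHazard rate x) := (M.monotone_flowHazard rate x).measurable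
  have hφ : Measurable (M.flow x) := (M.continuous_flow x).measurable
  have hm : Measurable fun p : (ℝ × ℝ) × ℝ => if M.flowHazard rate x p.1.2 < ENNReal.ofReal p.1.1
      then ENNReal.ofReal (Real.exp (-δ * p.1.2)) * M.levelPenalty lam G rate w δ
          (p.1.1 - (M.flowHazard rate x p.1.2).toReal) (p.2 * M.flow x p.1.2) else 0 :=
    Measurable.ite (measurableSet_lt (by fun_prop) (by fun_prop)) (Measurable.fun_mul (by fun_prop)
      (M.measurable_levelPenalty hlam G hrate hw δ (by fun_prop) (by fun_prop))) measurable_const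
  have hmean : Measurable fun p : ℝ × ℝ => M.meanPenalty lam G rate w δ (p.2 * M.flow x p.1) :=
    (M.measurable_meanPenalty hlam G hrate hw δ).comp (by fun_prop)
  -- Two applications of Tonelli bring the integral over the level innermost, so that memorylessness
  -- applies with `t` and `z` fixed.
  rw [lintegral_lintegral_swap (f := fun e t => ∫⁻ z, (if M.flowHazard rate x t < ENNReal.ofReal e
    then ENNReal.ofReal (Real.exp (-δ * t)) * M.levelPenalty lam G rate w δ
      (e - (M.flowHazard rate x t).toReal) (z * M.flow x t) else 0) ∂G)
    hm.lintegral_prod_right'.aemeasurable]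
  rw [← lintegral_expMeasure lam (f := fun t => ENNReal.ofReal (Real.exp (-δ * t)) *
    (ENNReal.ofReal (Real.exp (-(M.flowHazard rate x t).toReal)) *
      ∫⁻ z, M.meanPenalty lam G rate w δ (z * M.flow x t) ∂G))
    (Measurable.fun_mul (by fun_prop) (Measurable.fun_mul (by fun_prop)
      hmean.lintegral_prod_right'))]
  refine lintegral_congr fun t => ?_
  have hmt : Measurable fun p : ℝ × ℝ => if M.flowHazard rate x t < ENNReal.ofReal p.1
      then ENNReal.ofReal (Real.exp (-δ * t)) * M.levelPenalty lam G rate w δ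
          (p.1 - (M.flowHazard rate x t).toReal) (p.2 * M.flow x t) else 0 :=
    hm.comp (f := fun p : ℝ × ℝ => ((p.1, t), p.2)) (by fun_prop)
  rw [lintegral_lintegral_swap (f := fun e z => if M.flowHazard rate x t < ENNReal.ofReal e
    then ENNReal.ofReal (Real.exp (-δ * t)) * M.levelPenalty lam G rate w δ
      (e - (M.flowHazard rate x t).toReal) (z * M.flow x t) else 0) hmt.aemeasurable,
    ← mul_assoc, ← lintegral_const_mul' _ _
      (ENNReal.mul_ne_top ENNReal.ofReal_ne_top ENNReal.ofReal_ne_top)]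
  refine lintegral_congr fun z => ?_
  have hl : Measurable fun e => ENNReal.ofReal (Real.exp (-δ * t)) *
      M.levelPenalty lam G rate w δ e (z * M.flow x t) :=
    measurable_const.fun_mul
      (M.measurable_levelPenalty hlam G hrate hw δ measurable_const measurable_id)
  rw [lintegral_expMeasure_one_sub (ψ := fun e => ENNReal.ofReal (Real.exp (-δ * t)) *
      M.levelPenalty lam G rate w δ e (z * M.flow x t)) hl (hfin t),
    lintegral_const_mul' _ _ ENNReal.ofReal_ne_top, meanPenalty]
  ring

/-- The discount factor from the capital level `x` to the level `v` in the absence of losses. -/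
noncomputable def discount (M : CapitalModel) (rate : ℝ → ℝ≥0) (k x v : ℝ) : ℝ :=
  Real.exp (-(k * (M.age v - M.age x)) -
    (M.flowHazard rate x (M.age v - M.age x)).toReal)

/-- The renewal equation at the first loss. -/
theorem meanPenalty_eq (M : CapitalModel) {lam : ℝ} (hlam : 0 < lam) {G : Measure ℝ}
    [IsProbabilityMeasure G] (hG : ∀ᵐ z ∂G, z ∈ Icc (0 : ℝ) 1)
    {rate : ℝ → ℝ≥0} (hrate : Measurable rate)
    (hrate_int : ∀ a ∈ Ioo 0 M.xStar, IntegrableOn (fun u => (rate u : ℝ)) (Ico a M.xStar))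
    (hrate_zero : G {0} ≠ 0 → IntegrableOn (fun u => (rate u : ℝ)) (Ico 0 M.xStar))
    {w : ℝ → ℝ → ℝ≥0} (hw : Measurable (Function.uncurry w)) (δ : ℝ) {x : ℝ} (hx : 0 < x) :
    M.meanPenalty lam G rate w δ x =
      (∫⁻ v in Ioi x, ENNReal.ofReal (1 / M.drift v * M.discount rate (lam + δ) x v) *
        (M.killingRate rate v * w v |v - M.xStar|)) +
      ∫⁻ v in Ioi x, ENNReal.ofReal (lam / M.drift v * M.discount rate (lam + δ) x v) *
        ∫⁻ z, M.meanPenalty lam G rate w δ (v * z) ∂G := by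
  have := isProbabilityMeasure_expMeasure hlam
  have hfin : ∀ t, M.flowHazard rate x t ≠ ∞ := by
    refine fun t => (M.flowHazard_lt_top ?_ t).ne
    rcases lt_or_ge x M.xStar with h1 | h1
    · exact hrate_int _ ⟨hx, h1⟩
    · rw [Ico_eq_empty (not_lt.2 h1)]; exact integrableOn_empty
  have hτm : Measurable (hittingLevel (M.flowHazard rate x)) :=
    (monotone_hittingLevel _).measurable
  have hF := M.measurable_flowPenalty hw δ x
  have hm : Measurable fun p : ℝ × ℝ =>
      if hittingLevel (M.flowHazard rate x) p.1 < ENNReal.ofReal p.2 then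
        M.flowPenalty w δ x (hittingLevel (M.flowHazard rate x) p.1).toReal else 0 :=
    Measurable.ite (measurableSet_lt (by fun_prop) (by fun_prop)) (by fun_prop) measurable_const
  have hm1 (e : ℝ) : Measurable fun t : ℝ =>
      if hittingLevel (M.flowHazard rate x) e < ENNReal.ofReal t then
        M.flowPenalty w δ x (hittingLevel (M.flowHazard rate x) e).toReal else 0 :=
    Measurable.ite (measurableSet_lt measurable_const (by fun_prop)) measurable_const
      measurable_const
  have hsplit : M.meanPenalty lam G rate w δ x =
      ∫⁻ e, ((∫⁻ t, (if hittingLevel (M.flowHazard rate x) e < ENNReal.ofReal t then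
        M.flowPenalty w δ x (hittingLevel (M.flowHazard rate x) e).toReal else 0)
          ∂(expMeasure lam)) +
      ∫⁻ t, ∫⁻ z, (if M.flowHazard rate x t < ENNReal.ofReal e then
        ENNReal.ofReal (Real.exp (-δ * t)) * M.levelPenalty lam G rate w δ
          (e - (M.flowHazard rate x t).toReal) (z * M.flow x t) else 0)
            ∂G ∂(expMeasure lam)) ∂(expMeasure 1) := by
    refine lintegral_congr fun e => ?_
    rw [M.levelPenalty_eq hlam hG hrate hrate_int hrate_zero hw δ hx, lintegral_add_left (hm1 e)]
  -- Both contributions are time integrals along the flow; `lintegral_Ioi_age` rewrites them over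
  -- capital levels.
  rw [hsplit, lintegral_add_left hm.lintegral_prod_right', M.lintegral_penalty_before_loss hlam
    hrate hw δ hfin, M.lintegral_penalty_after_loss hlam hrate hw δ hfin, M.lintegral_Ioi_age x,
    M.lintegral_Ioi_age x]
  simp only [M.flow_age_sub, flowPenalty, discount]
  have hd (v : ℝ) : 0 ≤ 1 / M.drift v := (one_div_pos.2 (M.drift_pos v)).le
  congr 1
  · refine lintegral_congr fun v => ?_
    rw [ENNReal.ofReal_mul (hd v)]
    have hexp : Real.exp (-((lam + δ) * (M.age v - M.age x)) -
          (M.flowHazard rate x (M.age v - M.age x)).toReal) =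
        Real.exp (-(M.flowHazard rate x (M.age v - M.age x)).toReal) *
          (Real.exp (-δ * (M.age v - M.age x)) * Real.exp (-(lam * (M.age v - M.age x)))) := by
      rw [← Real.exp_add, ← Real.exp_add]; congr 1; ring
    rw [hexp, ENNReal.ofReal_mul (Real.exp_pos _).le, ENNReal.ofReal_mul (Real.exp_pos _).le]
    ring
  · refine lintegral_congr fun v => ?_
    have hexp : lam / M.drift v * Real.exp (-((lam + δ) * (M.age v - M.age x)) -
          (M.flowHazard rate x (M.age v - M.age x)).toReal) =
        1 / M.drift v * (lam * Real.exp (-(lam * (M.age v - M.age x)))) *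
          (Real.exp (-δ * (M.age v - M.age x)) *
            Real.exp (-(M.flowHazard rate x (M.age v - M.age x)).toReal)) := by
      rw [mul_assoc, mul_assoc, ← Real.exp_add, ← Real.exp_add, ← mul_assoc,
        one_div_mul_eq_div]; congr 2; ring
    rw [hexp, ENNReal.ofReal_mul (mul_nonneg (hd v) (by positivity)), ENNReal.ofReal_mul (hd v),
      ENNReal.ofReal_mul (Real.exp_pos _).le]
    simp_rw [mul_comm v]
    ring

end CapitalModel

/-! ### Explicit discount factors on the three regions. -/

/-- Only the ratio has to be positive, because `Real.log` is even. This covers `v - B < 0`, and `v +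
x**` of either sign according to the sign of `r - c_T`. -/
theorem exp_neg_mul_log_sub {p q : ℝ} (hp : p ≠ 0) (hq : q ≠ 0) (hpq : 0 < p / q) (a k : ℝ) :
    Real.exp (-(k * (1 / a * Real.log q - 1 / a * Real.log p))) = (p / q) ^ (k / a) := by
  rw [Real.rpow_def_of_pos hpq, Real.log_div hp hq]
  congr 1; ring

theorem lintegral_Ioi_eq_add {x y : ℝ} (h : x < y) (f : ℝ → ℝ≥0∞) :
    ∫⁻ v in Ioi x, f v = (∫⁻ v in Ioo x y, f v) + ∫⁻ v in Ioi y, f v := by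
  rw [← Ioc_union_Ioi_eq_Ioi h.le, lintegral_union measurableSet_Ioi
    (Set.disjoint_left.2 fun u hu hu' => absurd hu.2 (not_le.2 hu')),
    ← setLIntegral_congr Ioo_ae_eq_Ioc]

theorem lintegral_eq_Icc {G : Measure ℝ} (hG : ∀ᵐ z ∂G, z ∈ Icc (0 : ℝ) 1) (f : ℝ → ℝ≥0∞) :
    ∫⁻ z, f z ∂G = ∫⁻ z in Icc 0 1, f z ∂G := by
  rw [Measure.restrict_eq_self_of_ae_mem hG]

theorem lintegral_eq_Ico_add_Icc {G : Measure ℝ} (hG : ∀ᵐ z ∂G, z ∈ Icc (0 : ℝ) 1) {a : ℝ}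
    (h0 : 0 ≤ a) (h1 : a ≤ 1) (f : ℝ → ℝ≥0∞) :
    ∫⁻ z, f z ∂G = (∫⁻ z in Ico 0 a, f z ∂G) + ∫⁻ z in Icc a 1, f z ∂G := by
  rw [lintegral_eq_Icc hG, ← Ico_union_Icc_eq_Icc h0 h1, lintegral_union measurableSet_Icc
    (Set.disjoint_left.2 fun u hu hu' => absurd hu.2 (not_lt.2 hu'.1))]

theorem lintegral_eq_Ico_add_Ico_add_Icc {G : Measure ℝ} (hG : ∀ᵐ z ∂G, z ∈ Icc (0 : ℝ) 1)
    {a b : ℝ} (h0 : 0 ≤ a) (hab : a ≤ b) (h1 : b ≤ 1) (f : ℝ → ℝ≥0∞) :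
    ∫⁻ z, f z ∂G = (∫⁻ z in Ico 0 a, f z ∂G) + (∫⁻ z in Ico a b, f z ∂G) +
      ∫⁻ z in Icc b 1, f z ∂G := by
  rw [lintegral_eq_Ico_add_Icc hG (h0.trans hab) h1, ← Ico_union_Ico_eq_Ico h0 hab,
    lintegral_union measurableSet_Ico
      (Set.disjoint_left.2 fun u hu hu' => absurd hu.2 (not_lt.2 hu'.1))]

namespace CapitalModel

theorem drift_of_ge (M : CapitalModel) {u : ℝ} (h : M.B ≤ u) :
    M.drift u = M.r * (u - M.xStar) := by
  have := M.xStar_lt_B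
  rw [drift, max_eq_left (by linarith), max_eq_right (by linarith)]; ring

theorem drift_of_le (M : CapitalModel) {u : ℝ} (h : u ≤ M.xStar) :
    M.drift u = M.cT * (M.B - u) := by
  have := M.xStar_lt_B
  rw [drift, max_eq_right (by linarith), max_eq_left (by linarith)]; ring

/-- This is what `x**` is for: `-x**` is the zero of the affine function which the drift coincides
with between `x*` and `B`. -/
theorem drift_of_mem_Icc (M : CapitalModel) (hrc : M.r ≠ M.cT) {u : ℝ}
    (h : u ∈ Icc M.xStar M.B) : M.drift u = (M.r - M.cT) * (u + M.xStarStar) := by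
  have h0 : M.r - M.cT ≠ 0 := sub_ne_zero.2 hrc
  rw [drift, max_eq_left (by linarith [h.1]), max_eq_left (by linarith [h.2]), xStarStar]
  field_simp; ring

/-- `age` is itself an antiderivative of `1 / drift`, so travel times can be read off from any other
one. -/
theorem age_sub_eq (M : CapitalModel) {f : ℝ → ℝ} {x v : ℝ} (hxv : x ≤ v)
    (hf : ∀ u ∈ Icc x v, HasDerivAt f (1 / M.drift u) u) : M.age v - M.age x = f v - f x := by
  have hd : ∀ u ∈ Icc x v, HasDerivAt (fun u => M.age u - f u) 0 u := fun u hu => by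
    simpa using! (M.hasDerivAt_age u).sub (hf u hu)
  have := constant_of_has_deriv_right_zero
    (fun u hu => (hd u hu).continuousAt.continuousWithinAt)
    (fun u hu => (hd u (Ico_subset_Icc_self hu)).hasDerivWithinAt) v (right_mem_Icc.2 hxv)
  linarith

/-- The discount factor at rate `k` for the time it takes to grow from `x` to `v`. -/
noncomputable def growthDiscount (M : CapitalModel) (k x v : ℝ) : ℝ :=
  Real.exp (-(k * (M.age v - M.age x)))

theorem growthDiscount_nonneg (M : CapitalModel) (k x v : ℝ) : 0 ≤ M.growthDiscount k x v :=
  (Real.exp_pos _).le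

theorem growthDiscount_mul (M : CapitalModel) (k x y v : ℝ) :
    M.growthDiscount k x y * M.growthDiscount k y v = M.growthDiscount k x v := by
  rw [growthDiscount, growthDiscount, growthDiscount, ← Real.exp_add]
  congr 1; ring

theorem growthDiscount_of_le (M : CapitalModel) (k : ℝ) {x v : ℝ} (hxv : x ≤ v)
    (hv : v ≤ M.xStar) :
    M.growthDiscount k x v = ((v - M.B) / (x - M.B)) ^ (k / M.cT) := by
  have hB := M.xStar_lt_B
  have hc := M.cT_pos
  rw [growthDiscount, M.age_sub_eq (f := fun u => -(1 / M.cT * Real.log (u - M.B))) hxv,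
    ← exp_neg_mul_log_sub (by linarith) (by linarith)
      (div_pos_of_neg_of_neg (by linarith) (by linarith))]
  · congr 1; ring
  · intro u hu
    have hu' : u - M.B < 0 := by linarith [hu.2]
    refine ((((hasDerivAt_id u).sub_const M.B).log hu'.ne).const_mul (1 / M.cT)).neg.congr_deriv ?_
    rw [M.drift_of_le (hu.2.trans hv), ← neg_sub u M.B, ← mul_neg_one]
    have := hu'.ne
    simp only [id]
    field_simp

theorem add_xStarStar_ne_zero (M : CapitalModel) (hrc : M.r ≠ M.cT) {u : ℝ}
    (h : u ∈ Icc M.xStar M.B) : u + M.xStarStar ≠ 0 := by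
  intro h0
  have := M.drift_pos u
  rw [M.drift_of_mem_Icc hrc h, h0, mul_zero] at this
  exact lt_irrefl _ this

theorem growthDiscount_of_mem_Icc (M : CapitalModel) (hrc : M.r ≠ M.cT) (k : ℝ) {x v : ℝ}
    (hx : M.xStar ≤ x) (hxv : x ≤ v) (hv : v ≤ M.B) :
    M.growthDiscount k x v =
      ((x + M.xStarStar) / (v + M.xStarStar)) ^ (k / (M.r - M.cT)) := by
  have h0 : M.r - M.cT ≠ 0 := sub_ne_zero.2 hrc
  have hx' : x ∈ Icc M.xStar M.B := ⟨hx, hxv.trans hv⟩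
  have hv' : v ∈ Icc M.xStar M.B := ⟨hx.trans hxv, hv⟩
  -- The ratio equals a quotient of two drifts, both positive, whatever the sign of `r - c_T`.
  have hratio : 0 < (x + M.xStarStar) / (v + M.xStarStar) := by
    have := div_pos (M.drift_pos x) (M.drift_pos v)
    rwa [M.drift_of_mem_Icc hrc hx', M.drift_of_mem_Icc hrc hv', mul_div_mul_left _ _ h0] at this
  rw [growthDiscount, M.age_sub_eq
    (f := fun u => 1 / (M.r - M.cT) * Real.log (u + M.xStarStar)) hxv,
    ← exp_neg_mul_log_sub (M.add_xStarStar_ne_zero hrc hx') (M.add_xStarStar_ne_zero hrc hv')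
      hratio]
  intro u hu
  have hu' : u ∈ Icc M.xStar M.B := ⟨hx.trans hu.1, hu.2.trans hv⟩
  have hne := M.add_xStarStar_ne_zero hrc hu'
  refine ((((hasDerivAt_id u).add_const M.xStarStar).log hne).const_mul _).congr_deriv ?_
  rw [M.drift_of_mem_Icc hrc hu']
  simp only [id]
  field_simp

theorem div_drift_mul_growthDiscount_of_ge (M : CapitalModel) (lam k : ℝ) {x v : ℝ}
    (hx : M.B ≤ x) (hxv : x ≤ v) :
    lam / M.drift v * M.growthDiscount k x v =
      lam / M.r * (x - M.xStar) ^ (k / M.r) * (1 / (v - M.xStar) ^ (k / M.r + 1)) := by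
  have hB := M.xStar_lt_B
  have hr := M.r_pos
  have hx' : 0 < x - M.xStar := by linarith
  have hv' : 0 < v - M.xStar := by linarith
  rw [growthDiscount, M.age_sub_eq (f := fun u => 1 / M.r * Real.log (u - M.xStar)) hxv,
    exp_neg_mul_log_sub hx'.ne' hv'.ne' (div_pos hx' hv'), M.drift_of_ge (hx.trans hxv),
    Real.div_rpow hx'.le hv'.le, Real.rpow_add_one hv'.ne']
  · have := (Real.rpow_pos_of_pos hv' (k / M.r)).ne'
    field_simp
  · intro u hu
    have hu' : 0 < u - M.xStar := by linarith [hu.1]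
    refine ((((hasDerivAt_id u).sub_const M.xStar).log hu'.ne').const_mul _).congr_deriv ?_
    rw [M.drift_of_ge (hx.trans hu.1)]
    simp only [id]
    field_simp

theorem discount_eq (M : CapitalModel) (rate : ℝ → ℝ≥0) (k x v : ℝ) :
    M.discount rate k x v = M.growthDiscount k x v *
      Real.exp (-(M.flowHazard rate x (M.age v - M.age x)).toReal) := by
  rw [discount, growthDiscount, ← Real.exp_add, sub_eq_add_neg]

theorem discount_of_ge (M : CapitalModel) (rate : ℝ → ℝ≥0) (k : ℝ) {x : ℝ} (hx : M.xStar ≤ x)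
    (v : ℝ) : M.discount rate k x v = M.growthDiscount k x v := by
  rw [discount_eq, flowHazard_age_sub, setLIntegral_congr_fun (g := 0) measurableSet_Ioo]
  · simp
  · intro u hu
    simp [not_lt.2 (hx.trans hu.1.le)]

/-- The hazard stops growing once the flow passes `x*`, hence the truncation of `v` there. -/
theorem flowHazard_age_sub_eq_min (M : CapitalModel) (rate : ℝ → ℝ≥0) (x v : ℝ) :
    M.flowHazard rate x (M.age v - M.age x) =
      ∫⁻ u in Ioo x (min v M.xStar), ENNReal.ofReal (rate u / (M.cT * (M.B - u))) := by
  have hB := M.xStar_lt_B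
  have hc := M.cT_pos
  have hset : Ioo x (min v M.xStar) = Iio M.xStar ∩ Ioo x v := by
    ext u; simp only [mem_Ioo, lt_min_iff, mem_inter_iff, mem_Iio]; tauto
  rw [flowHazard_age_sub, hset, ← Measure.restrict_restrict measurableSet_Iio,
    ← lintegral_indicator measurableSet_Iio]
  refine lintegral_congr fun u => ?_
  by_cases hu : u < M.xStar
  · have hpos : 0 < M.cT * (M.B - u) := mul_pos hc (by linarith)
    rw [indicator_of_mem (show u ∈ Iio _ from hu), if_pos hu, M.drift_of_le hu.le,
      ← ENNReal.ofReal_coe_nnreal, ← ENNReal.ofReal_mul (by positivity), one_div_mul_eq_div]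
  · rw [indicator_of_notMem (show u ∉ Iio _ from hu), if_neg hu, mul_zero]

/-- The integrand has constant sign, so the Bochner integral is the real part of the lower integral;
should the latter be infinite, both conventions give `0`. The sign in the exponent is absorbed by
writing `u - B` for `B - u`. -/
theorem discount_of_lt (M : CapitalModel) {rate : ℝ → ℝ≥0} (hrate : Measurable rate) (k : ℝ)
    {x v : ℝ} (hxv : x ≤ v) (hx : x ≤ M.xStar) :
    M.discount rate k x v = M.growthDiscount k x v *
      Real.exp (1 / M.cT * ∫ u in x..min v M.xStar, rate u / (u - M.B)) := by
  have hB := M.xStar_lt_B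
  have hc := M.cT_pos
  rw [discount_eq, flowHazard_age_sub_eq_min]
  congr 2
  have hm : Measurable fun u => (rate u : ℝ) / (M.cT * (M.B - u)) :=
    hrate.coe_nnreal_real.div (by fun_prop)
  rw [← integral_eq_lintegral_of_nonneg_ae _ hm.aestronglyMeasurable,
    intervalIntegral.integral_of_le (le_min hxv hx), integral_Ioc_eq_integral_Ioo,
    ← integral_const_mul, ← integral_neg]
  · refine setIntegral_congr_fun measurableSet_Ioo fun u hu => ?_
    have hu' : u < M.xStar := hu.2.trans_le (min_le_right _ _)
    have h1 : M.B - u ≠ 0 := by linarith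
    have h2 : u - M.B ≠ 0 := by linarith
    rw [← neg_sub u M.B]
    field_simp
  · refine (ae_restrict_mem measurableSet_Ioo).mono fun u hu => ?_
    have hu' : u < M.xStar := hu.2.trans_le (min_le_right _ _)
    exact div_nonneg (rate u).coe_nonneg (mul_nonneg hc.le (by linarith))

theorem killingRate_of_ge (M : CapitalModel) (rate : ℝ → ℝ≥0) {u : ℝ} (h : M.xStar ≤ u) :
    M.killingRate rate u = 0 := if_neg (not_lt.2 h)

end CapitalModel

/-! ### The three formulas. -/

theorem theorem4p1 (M : CapitalModel) {Ω : Type*} [MeasurableSpace Ω]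
    (P : Measure Ω) [IsProbabilityMeasure P]
    (lam : ℝ) (hlam : 0 < lam) (δ : ℝ) (hδ : 0 ≤ δ)
    (G : Measure ℝ) [IsProbabilityMeasure G] (hG : ∀ᵐ z ∂G, z ∈ Icc (0 : ℝ) 1)
    (T Z : ℕ → Ω → ℝ) (E : Ω → ℝ) (hnoise : IsCapitalNoise P lam G T Z E)
    (rate : ℝ → ℝ≥0) (hrate : Measurable rate)
    (hrate_int : ∀ a ∈ Ioo 0 M.xStar, IntegrableOn (fun u => (rate u : ℝ)) (Ico a M.xStar))
    (hrate_zero : G {0} ≠ 0 → IntegrableOn (fun u => (rate u : ℝ)) (Ico 0 M.xStar))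
    (w : ℝ → ℝ → ℝ≥0) (hw : Measurable (Function.uncurry w))
    (m : ℝ → ℝ≥0∞) (hm : ∀ x, m x = M.expectedPenalty P T Z E rate w δ x) :
    (∀ x, M.B ≤ x →
      m x = ENNReal.ofReal (lam / M.r * (x - M.xStar) ^ ((lam + δ) / M.r)) *
        ∫⁻ v in Ioi x, ENNReal.ofReal (1 / (v - M.xStar) ^ ((lam + δ) / M.r + 1)) *
          (∫⁻ z in Ico 0 (M.xStar / v), m (v * z) ∂G
            + ∫⁻ z in Ico (M.xStar / v) (M.B / v), m (v * z) ∂G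
            + ∫⁻ z in Icc (M.B / v) 1, m (v * z) ∂G)) ∧
    (M.r ≠ M.cT → ∀ x, M.xStar ≤ x → x < M.B →
      m x =
        (∫⁻ v in Ioo x M.B,
          ENNReal.ofReal (lam / (M.r - M.cT) *
            ((x + M.xStarStar) / (v + M.xStarStar)) ^ ((lam + δ) / (M.r - M.cT)) /
              (v + M.xStarStar)) *
          (∫⁻ z in Ico 0 (M.xStar / v), m (v * z) ∂G
            + ∫⁻ z in Icc (M.xStar / v) 1, m (v * z) ∂G))
        + ENNReal.ofReal (lam / M.r * (M.B - M.xStar) ^ ((lam + δ) / M.r) *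
            ((x + M.xStarStar) / (M.B + M.xStarStar)) ^ ((lam + δ) / (M.r - M.cT))) *
          ∫⁻ v in Ioi M.B, ENNReal.ofReal (1 / (v - M.xStar) ^ ((lam + δ) / M.r + 1)) *
            (∫⁻ z in Ico 0 (M.xStar / v), m (v * z) ∂G
              + ∫⁻ z in Ico (M.xStar / v) (M.B / v), m (v * z) ∂G
              + ∫⁻ z in Icc (M.B / v) 1, m (v * z) ∂G)) ∧
    (M.r ≠ M.cT → ∀ x, 0 < x → x < M.xStar →
      m x =
        (∫⁻ v in Ioo x M.xStar,
          ENNReal.ofReal (-(1 / M.cT) * ((v - M.B) / (x - M.B)) ^ ((lam + δ) / M.cT) / (v - M.B) *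
            Real.exp (1 / M.cT * ∫ u in x..v, rate u / (u - M.B))) *
          (rate v * w v (M.xStar - v)))
        + (∫⁻ v in Ioo x M.xStar,
          ENNReal.ofReal (-(lam / M.cT) * ((v - M.B) / (x - M.B)) ^ ((lam + δ) / M.cT) / (v - M.B) *
            Real.exp (1 / M.cT * ∫ u in x..v, rate u / (u - M.B))) *
          ∫⁻ z in Icc 0 1, m (v * z) ∂G)
        + (∫⁻ v in Ioo M.xStar M.B,
          ENNReal.ofReal (lam / (M.r - M.cT) *
            ((M.xStar - M.B) / (x - M.B)) ^ ((lam + δ) / M.cT) *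
            ((M.xStar + M.xStarStar) / (v + M.xStarStar)) ^ ((lam + δ) / (M.r - M.cT)) /
              (v + M.xStarStar) *
            Real.exp (1 / M.cT * ∫ u in x..M.xStar, rate u / (u - M.B))) *
          (∫⁻ z in Ico 0 (M.xStar / v), m (v * z) ∂G
            + ∫⁻ z in Icc (M.xStar / v) 1, m (v * z) ∂G))
        + ENNReal.ofReal (lam / M.r * ((M.xStar - M.B) / (x - M.B)) ^ ((lam + δ) / M.cT) *
            ((M.xStar + M.xStarStar) / (M.B + M.xStarStar)) ^ ((lam + δ) / (M.r - M.cT)) *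
            (M.B - M.xStar) ^ ((lam + δ) / M.r)) *
          ∫⁻ v in Ioi M.B, ENNReal.ofReal (1 / (v - M.xStar) ^ ((lam + δ) / M.r + 1) *
              Real.exp (1 / M.cT * ∫ u in x..M.xStar, rate u / (u - M.B))) *
            (∫⁻ z in Ico 0 (M.xStar / v), m (v * z) ∂G
              + ∫⁻ z in Ico (M.xStar / v) (M.B / v), m (v * z) ∂G
              + ∫⁻ z in Icc (M.B / v) 1, m (v * z) ∂G)) := by
  have hx0 := M.xStar_pos
  have hxB := M.xStar_lt_B
  have hr := M.r_pos
  have hc := M.cT_pos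
  have hB0 : 0 < M.B := hx0.trans hxB
  have hmean : m = M.meanPenalty lam G rate w δ :=
    funext fun x => (hm x).trans (M.expectedPenalty_eq hlam hnoise hrate hw δ x)
  have hrenew (x : ℝ) (hx : 0 < x) : m x =
      (∫⁻ v in Ioi x, ENNReal.ofReal (1 / M.drift v * M.discount rate (lam + δ) x v) *
        (M.killingRate rate v * w v |v - M.xStar|)) +
      ∫⁻ v in Ioi x, ENNReal.ofReal (lam / M.drift v * M.discount rate (lam + δ) x v) *
        ∫⁻ z, m (v * z) ∂G := by
    rw [hmean]
    exact M.meanPenalty_eq hlam hG hrate hrate_int hrate_zero hw δ hx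
  -- There is no killing at or above `x*`, so the term for poverty before the first loss lives on
  -- levels below `x*`.
  have hfirst (y : ℝ) (hy : M.xStar ≤ y) (x : ℝ) :
      ∫⁻ v in Ioi y, ENNReal.ofReal (1 / M.drift v * M.discount rate (lam + δ) x v) *
        (M.killingRate rate v * w v |v - M.xStar|) = 0 := by
    rw [setLIntegral_congr_fun (g := 0) measurableSet_Ioi fun v hv => ?_]
    · simp
    · simp [M.killingRate_of_ge rate (hy.trans (le_of_lt hv))]
  have hA (v : ℝ) (hv : M.B ≤ v) : ∫⁻ z, m (v * z) ∂G =
      ∫⁻ z in Ico 0 (M.xStar / v), m (v * z) ∂G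
            + ∫⁻ z in Ico (M.xStar / v) (M.B / v), m (v * z) ∂G
            + ∫⁻ z in Icc (M.B / v) 1, m (v * z) ∂G := by
    have hv0 : 0 < v := hB0.trans_le hv
    exact lintegral_eq_Ico_add_Ico_add_Icc hG (by positivity) (by gcongr) ((div_le_one hv0).2 hv) _
  have hC (v : ℝ) (hv : M.xStar ≤ v) : ∫⁻ z, m (v * z) ∂G =
      ∫⁻ z in Ico 0 (M.xStar / v), m (v * z) ∂G + ∫⁻ z in Icc (M.xStar / v) 1, m (v * z) ∂G := by
    have hv0 : 0 < v := hx0.trans_le hv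
    exact lintegral_eq_Ico_add_Icc hG (by positivity) ((div_le_one hv0).2 hv) _
  have hpow (x : ℝ) (hx : M.xStar ≤ x) (p : ℝ) : 0 ≤ (x - M.xStar) ^ p :=
    Real.rpow_nonneg (sub_nonneg.2 hx) p
  refine ⟨fun x hx => ?_, fun hrc x hx hxB' => ?_, fun hrc x hx hxs => ?_⟩
  · have hsx : M.xStar ≤ x := hxB.le.trans hx
    rw [hrenew x (hx0.trans_le hsx), hfirst x hsx, zero_add,
      ← lintegral_const_mul' _ _ ENNReal.ofReal_ne_top]
    refine setLIntegral_congr_fun measurableSet_Ioi fun v hv => ?_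
    have hv' : M.B ≤ v := hx.trans (le_of_lt hv)
    rw [hA v hv', M.discount_of_ge rate _ hsx, M.div_drift_mul_growthDiscount_of_ge _ _ hx
      (le_of_lt hv), ENNReal.ofReal_mul (mul_nonneg (by positivity) (hpow x hsx _)), mul_assoc]
  · rw [hrenew x (hx0.trans_le hx), hfirst x hx, zero_add, lintegral_Ioi_eq_add hxB',
      ← lintegral_const_mul' _ _ ENNReal.ofReal_ne_top]
    congr 1
    · refine setLIntegral_congr_fun measurableSet_Ioo fun v hv => ?_
      rw [hC v (hx.trans hv.1.le), M.discount_of_ge rate _ hx,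
        M.growthDiscount_of_mem_Icc hrc _ hx hv.1.le hv.2.le,
        M.drift_of_mem_Icc hrc ⟨hx.trans hv.1.le, hv.2.le⟩]
      congr 2
      rw [← div_div]; ring
    · refine setLIntegral_congr_fun measurableSet_Ioi fun v hv => ?_
      have hv' : M.B ≤ v := le_of_lt hv
      -- The journey from `x` to `v > B` is cut at `B`; the factor from `x` to `B` does not depend
      -- on `v` and forms the constant in front of the integral.
      rw [hA v hv', M.discount_of_ge rate _ hx, ← M.growthDiscount_mul _ x M.B v,
        ← M.growthDiscount_of_mem_Icc hrc _ hx hxB'.le le_rfl, ← mul_assoc (ENNReal.ofReal _),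
        ← ENNReal.ofReal_mul (mul_nonneg (mul_nonneg (by positivity) (hpow _ hxB.le _))
          (M.growthDiscount_nonneg _ _ _)), mul_left_comm,
        M.div_drift_mul_growthDiscount_of_ge _ _ le_rfl hv']
      congr 2
      ring
  · have hmin (v : ℝ) (hv : M.xStar ≤ v) : min v M.xStar = M.xStar := min_eq_right hv
    -- The killing term survives only on `(x, x*)`, while the loss term is cut at `x*` and at `B`;
    -- these are the four summands.
    rw [hrenew x hx, lintegral_Ioi_eq_add hxs, hfirst _ le_rfl, add_zero,
      lintegral_Ioi_eq_add hxs, lintegral_Ioi_eq_add hxB,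
      ← lintegral_const_mul' _ _ ENNReal.ofReal_ne_top, ← add_assoc, ← add_assoc]
    have hlow (a v : ℝ) (hv : v ∈ Ioo x M.xStar) :
        a / M.drift v * M.discount rate (lam + δ) x v =
          -(a / M.cT) * ((v - M.B) / (x - M.B)) ^ ((lam + δ) / M.cT) / (v - M.B) *
            Real.exp (1 / M.cT * ∫ u in x..v, rate u / (u - M.B)) := by
      rw [M.discount_of_lt hrate _ hv.1.le hxs.le, min_eq_left hv.2.le,
        M.growthDiscount_of_le _ hv.1.le hv.2.le, M.drift_of_le hv.2.le, ← neg_sub v M.B]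
      have : v - M.B ≠ 0 := by linarith [hv.2]
      field_simp
    congr 1
    · congr 1
      · congr 1
        · refine setLIntegral_congr_fun measurableSet_Ioo fun v hv => ?_
          rw [hlow 1 v hv, CapitalModel.killingRate, if_pos hv.2, abs_sub_comm, abs_of_pos (sub_pos.2 hv.2)]
        · refine setLIntegral_congr_fun measurableSet_Ioo fun v hv => ?_
          rw [hlow lam v hv, ← lintegral_eq_Icc hG]
      · refine setLIntegral_congr_fun measurableSet_Ioo fun v hv => ?_
        rw [hC v hv.1.le, M.discount_of_lt hrate _ (hxs.trans hv.1).le hxs.le, hmin v hv.1.le,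
          ← M.growthDiscount_mul _ x M.xStar v, M.growthDiscount_of_le _ hxs.le le_rfl,
          M.growthDiscount_of_mem_Icc hrc _ le_rfl hv.1.le hv.2.le,
          M.drift_of_mem_Icc hrc ⟨hv.1.le, hv.2.le⟩]
        congr 2
        rw [← div_div]; ring
    · refine setLIntegral_congr_fun measurableSet_Ioi fun v hv => ?_
      have hv' : M.B ≤ v := le_of_lt hv
      rw [hA v hv', M.discount_of_lt hrate _ (hxs.le.trans (hxB.le.trans hv')) hxs.le,
        hmin v (hxB.le.trans hv'), ← M.growthDiscount_mul _ x M.B v,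
        ← M.growthDiscount_mul _ x M.xStar M.B,
        ← M.growthDiscount_of_le _ hxs.le le_rfl,
        ← M.growthDiscount_of_mem_Icc hrc _ le_rfl hxB.le le_rfl, ← mul_assoc (ENNReal.ofReal _),
        ← ENNReal.ofReal_mul (mul_nonneg (mul_nonneg (mul_nonneg (by positivity)
          (M.growthDiscount_nonneg _ _ _)) (M.growthDiscount_nonneg _ _ _)) (hpow _ hxB.le _))]
      congr 2
      -- This handles the stretch above `B`; the discount factors from `x` to `x*` and from `x*` to
      -- `B`, and the exponential of the hazard, are common multipliers.
      have := M.div_drift_mul_growthDiscount_of_ge lam (lam + δ) le_rfl hv'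
      linear_combination M.growthDiscount (lam + δ) x M.xStar *
        M.growthDiscount (lam + δ) M.xStar M.B *
        Real.exp (1 / M.cT * ∫ u in x..M.xStar, rate u / (u - M.B)) * this
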